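/- **Conventions.** A represented space is a set $X$ with a partial surjection $\delta_X:\subseteq\mathbb N^{\mathbb N}\to X$; a sequence $p$ with $\delta_X(p)=x$ is a name of $x$. A (possibly partial or multivalued) map $f$ between represented spaces is computable relative to an oracle $o\in\mathbb N^{\mathbb N}$ if a machine with oracle $o$ maps every name of every $x\in\operatorname{dom} f$ to a name of an element of $f(x)$; it is computable if no oracle is needed, and it is continuous iff it is computable relative to some oracle. $X\cong Y$ (relative to $o$) means that there is a bijection that is computable (relative to $o$) in both directions. A name of $f\in\mathcal C(X,Y)$ is the number of a machine followed by an oracle with which it realizes $f$. $\mathbb S=\{\bot,\top\}$ is Sierpiński space, where exactly $0^{\mathbb N}$ names $\bot$; $\mathcal O(X)$ is the space of all $U\subseteq X$ whose characteristic map is in $\mathcal C(X,\mathbb S)$, with the names of that map. $X_\kappa$ is the subspace $\{\kappa(x)\mid x\in X\}$ of $\mathcal O(\mathcal O(X))$, where $\kappa(x)=\{U\in\mathcal O(X)\mid x\in U\}$. For a relation $\prec$ with $\{(x,y)\mid x\prec y\}\in\mathcal O(X\times X)$, $X_\prec$ is the image of $X$ in $\mathcal O(X)$ under $x\mapsto\{y\mid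 y\prec x\}$, and $X_\succ$ the image under $x\mapsto\{y\mid x\prec y\}$. $X\wedge Y$ is the space on $X\cap Y$ in which $\langle p,q\rangle$ names $x$ iff $p$ names $x$ in $X$ and $q$ names $x$ in $Y$. In $X_\prec\wedge X_\succ$ a name of (the class of) a point $x\in X$ is a pair of a name of $x$ in $X_\prec$ and a name of $x$ in $X_\succ$; two points of $X$ are identified iff they have the same image both in $X_\prec$ and in $X_\succ$. If $x\mapsto\{y\mid y\prec x\}$ and $x\mapsto\{y\mid x\prec y\}$ are injective (e.g. if $\prec$ is a linear order), then $X_\prec$ and $X_\succ$ can be regarded as spaces with underlying set $X$, and $\wedge$ is the operation just defined. $\mathcal K(X)$ is the space of saturated compact sets $A\subseteq X$, named as $\{U\in\mathcal O(X)\mid A\subseteq U\}\in\mathcal O(\mathcal O(X))$; $\mathcal V(X)$ is the space of closed sets $\overline A$ with $A\subseteq X$ and $\{U\in\mathcal O(X)\mid U\cap A\neq\emptyset\}\in\mathcal O(\mathcal O(X))$, named by names of the latter. In $\mathbb R$, $p$ is a name of $x$ iff $|\nu_{\mathbb Q}(p(n))-x|<2^{-n}$ for all $n$, where $\nu_{\mathbb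 Q}$ is a standard numbering of $\mathbb Q$; $\mathbb R_<$ and $\mathbb R_>$ are the spaces $X_\prec$ and $X_\succ$ for $X=\mathbb R$ and $\prec$ the usual order $<$. **Statement.** 1. Let $X$ be a represented space, $\prec$ a binary relation (in particular, an order) on $X$, and $o$ an oracle such that $\{(x,y)\mid x\prec y\}$ is a computable element of $\mathcal O(X\times X)$ relative to $o$. Let the intervals of $\prec$ be an effective base for $\mathcal O(X)$ relative to $o$, i.e. let the map $(a_i,b_i)_{i\in\mathbb N}\mapsto\bigcup_{i\in\mathbb N}\{x\mid a_i\prec x\prec b_i\}$ from $\mathcal C(\mathbb N,X\times X)$ to $\mathcal O(X)$ be surjective and have a multivalued right inverse that is computable relative to $o$. Then $X_\kappa\cong X_\prec\wedge X_\succ$ relative to $o$, by the canonical bijection, which takes $\kappa(x)$ to $x$. (A computable $o$ gives the computable version, arbitrary $o$ the continuous one.) 2. $\mathbb R\cong\mathbb R_<\wedge\mathbb R_>$, by the identity map. 3. Every nonempty $A\in\mathcal K(\mathbb R)\wedge\mathcal V(\mathbb R)$ has a greatest element, and the partial map $\max:\subseteq\mathcal K(\mathbb R)\wedge\mathcal V(\mathbb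 R)\to\mathbb R$, defined on the nonempty sets, is computable. -/

import Mathlib

/-- Infinite sequences of natural numbers: inputs, oracles and outputs of the machines. -/
abbrev Baire : Type := ℕ → ℕ

namespace Baire

/-- The pairing `⟨p, q⟩` of sequences: `p` on the even places, `q` on the odd places. -/
def pair (p q : Baire) : Baire := fun n => if n % 2 = 0 then p (n / 2) else q (n / 2)

/-- First component of a paired sequence. -/
def fst (r : Baire) : Baire := fun n => r (2 * n)

/-- Second component of a paired sequence. -/
def snd (r : Baire) : Baire := fun n => r (2 * n + 1)

/-- The sequence without its first entry. -/
def tail (r : Baire) : Baire := fun n => r (n + 1)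

/-- The list `[r 0, …, r (m - 1)]`. -/
def take (r : Baire) (m : ℕ) : List ℕ := (List.range m).map r

end Baire

/-- What the `e`-th program answers, when it is asked for place `k` of its output and has so far
read the first `m` places of its tape `r`. Programs are Mathlib's codes of partial recursive
functions. The answer `0` means "read one more place", the answer `v + 1` means "the entry is `v`";
the computation may also diverge. -/
def machineAnswer (e : ℕ) (r : Baire) (m k : ℕ) : Part ℕ :=
  (Denumerable.ofNat Nat.Partrec.Code e).eval (Nat.pair (Encodable.encode (r.take m)) k)

/-- The `e`-th machine with tape `r` writes `v` on place `k` of its output: it reads its tape place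
by place until it answers with `v`. -/
def MachineWrites (e : ℕ) (r : Baire) (k v : ℕ) : Prop :=
  ∃ m, v + 1 ∈ machineAnswer e r m k ∧ ∀ j < m, 0 ∈ machineAnswer e r j k

/-- The `e`-th machine with oracle `o` and input `p` has the infinite output `q`. -/
def MachineComputes (e : ℕ) (o p q : Baire) : Prop :=
  ∀ k, MachineWrites e (Baire.pair o p) k (q k)

theorem MachineComputes.unique {e : ℕ} {o p q q' : Baire} (h : MachineComputes e o p q)
    (h' : MachineComputes e o p q') : q = q' := by
  funext k
  obtain ⟨m, hm, hlt⟩ := h k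
  obtain ⟨m', hm', hlt'⟩ := h' k
  rcases lt_trichotomy m m' with hh | hh | hh
  · exact absurd (Part.mem_unique hm (hlt' m hh)) (Nat.succ_ne_zero _)
  · subst hh
    exact Nat.succ_injective (Part.mem_unique hm hm')
  · exact absurd (Part.mem_unique hm' (hlt m' hh)) (Nat.succ_ne_zero _)

/-- A represented space whose underlying set is a subset of the type `α`: a partial map `δ` from
sequences to `α`, given by its graph (`Names p x` says that `δ(p)` is defined and equal to `x`).
The underlying set is the range of `δ`. -/
structure RepSpace (α : Type*) where
  Names : Baire → α → Prop
  functional : ∀ {p x y}, Names p x → Names p y → x = y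

namespace RepSpace

variable {α β : Type*}

/-- The underlying set of a represented space. -/
def carrier (X : RepSpace α) : Set α := {x | ∃ p, X.Names p x}

/-- The `e`-th machine with oracle `o` computes a realizer of the multivalued partial map `T` (whose
domain is the set of all `x` with `T x` nonempty). -/
def Realizes (X : RepSpace α) (Y : RepSpace β) (e : ℕ) (o : Baire)
    (T : X.carrier → Set Y.carrier) : Prop :=
  ∀ (p : Baire) (x : X.carrier), X.Names p x → (T x).Nonempty →
    ∃ q, MachineComputes e o p q ∧ ∃ y ∈ T x, Y.Names q y

/-- The multivalued partial map `T` is computable relative to the oracle `o`. -/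
def ComputableMultiIn (o : Baire) (X : RepSpace α) (Y : RepSpace β)
    (T : X.carrier → Set Y.carrier) : Prop :=
  ∃ e, Realizes X Y e o T

/-- The map `f` is computable relative to the oracle `o`. -/
def ComputableMapIn (o : Baire) (X : RepSpace α) (Y : RepSpace β)
    (f : X.carrier → Y.carrier) : Prop :=
  ComputableMultiIn o X Y fun x => {f x}

/-- The bijection `f` and its inverse are computable relative to the oracle `o`. -/
def ComputableIsoIn (o : Baire) (X : RepSpace α) (Y : RepSpace β)
    (f : X.carrier ≃ Y.carrier) : Prop :=
  ComputableMapIn o X Y f ∧ ComputableMapIn o Y X f.symm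

/-- Subspaces. -/
def restrict (X : RepSpace α) (A : Set α) : RepSpace α where
  Names p x := X.Names p x ∧ x ∈ A
  functional h h' := X.functional h.1 h'.1

/-- Products. -/
def prod (X : RepSpace α) (Y : RepSpace β) : RepSpace (α × β) where
  Names r z := X.Names r.fst z.1 ∧ Y.Names r.snd z.2
  functional h h' := Prod.ext (X.functional h.1 h'.1) (Y.functional h.2 h'.2)

/-- The meet `X ∧ Y`: the underlying set is `X ∩ Y`, and `⟨p, q⟩` is a name of `x` iff `p` names `x`
in `X` and `q` names `x` in `Y`. -/
def meet (X Y : RepSpace α) : RepSpace α where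
  Names r x := X.Names r.fst x ∧ Y.Names r.snd x
  functional h h' := X.functional h.1 h'.1

/-- The space of natural numbers. -/
def natSpace : RepSpace ℕ where
  Names p n := p 0 = n
  functional h h' := h.symm.trans h'

/-- Sierpinski space: the zero sequence names `⊥ = False`, all others name `⊤ = True`. -/
def sierp : RepSpace Prop where
  Names p b := b ↔ p ≠ 0
  functional h h' := propext (h.trans h'.symm)

theorem mem_sierp (b : Prop) : b ∈ sierp.carrier := by
  by_cases hb : b
  · exact ⟨1, by simp [sierp, hb]⟩
  · exact ⟨0, by simp [sierp, hb]⟩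

/-- The space `C(X, Y)`: a name of `f` consists of a number `e` followed by an oracle with which the
`e`-th machine computes a realizer of `f`. -/
def funSpace (X : RepSpace α) (Y : RepSpace β) : RepSpace (X.carrier → Y.carrier) where
  Names r f := Realizes X Y (r 0) r.tail fun x => {f x}
  functional := by
    intro r f g hf hg
    funext x
    obtain ⟨p, hp⟩ := x.2
    obtain ⟨q, hq, y, hy, hqy⟩ := hf p x hp ⟨_, rfl⟩
    obtain ⟨q', hq', y', hy', hqy'⟩ := hg p x hp ⟨_, rfl⟩
    obtain rfl := hq.unique hq'
    have h1 : y = f x := hy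
    have h2 : y' = g x := hy'
    rw [← h1, ← h2]
    exact Subtype.ext (Y.functional hqy hqy')

/-- The characteristic map of `U` on `X`, with values in Sierpinski space. -/
def charMap (X : RepSpace α) (U : Set α) : X.carrier → sierp.carrier :=
  fun x => ⟨(x : α) ∈ U, mem_sierp _⟩

/-- The space `O(X)` of open subsets of `X`: a subset of `X` is identified with its characteristic
map in `C(X, S)`. -/
def opens (X : RepSpace α) : RepSpace (Set α) where
  Names r U := U ⊆ X.carrier ∧ (funSpace X sierp).Names r (X.charMap U)
  functional := by
    rintro r U V ⟨hU, hr⟩ ⟨hV, hr'⟩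
    have h := (funSpace X sierp).functional hr hr'
    have key : ∀ x ∈ X.carrier, (x ∈ U ↔ x ∈ V) := fun x hx =>
      iff_of_eq (congrArg Subtype.val (congrFun h ⟨x, hx⟩))
    ext x
    exact ⟨fun hx => (key x (hU hx)).1 hx, fun hx => (key x (hV hx)).2 hx⟩

/-- `U` is a computable element of `O(X)` relative to the oracle `o`. -/
def ComputableOpenIn (o : Baire) (X : RepSpace α) (U : Set α) : Prop :=
  ComputableMapIn o X sierp (X.charMap U)

/-- `κ(x) = {U ∈ O(X) | x ∈ U}`. -/
def kappa (X : RepSpace α) (x : α) : Set (Set α) := {U | U ∈ X.opens.carrier ∧ x ∈ U}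

/-- The space `X_κ`, the image of `X` in `O(O(X))` under `κ`. -/
def kappaSpace (X : RepSpace α) : RepSpace (Set (Set α)) :=
  X.opens.opens.restrict (X.kappa '' X.carrier)

/-- `{y ∈ X | R y x}`. -/
def cut (X : RepSpace α) (R : α → α → Prop) (x : α) : Set α := {y | y ∈ X.carrier ∧ R y x}

/-- The space `X_R`, the image of `X` in `O(X)` under `x ↦ {y ∈ X | R y x}`. -/
def cutSpace (X : RepSpace α) (R : α → α → Prop) : RepSpace (Set α) :=
  X.opens.restrict (X.cut R '' X.carrier)

/-- The space `X_R` when the quotient map from `X` to `X_R` is injective, with the points of `X_R`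
identified with those of `X`. -/
def cutPoints (X : RepSpace α) (R : α → α → Prop) (h : Set.InjOn (X.cut R) X.carrier) :
    RepSpace α where
  Names p x := x ∈ X.carrier ∧ (X.cutSpace R).Names p (X.cut R x)
  functional hx hy := h hx.1 hy.1 ((X.cutSpace R).functional hx.2 hy.2)

/-- The joint quotient `X_R ∧ X_S` without an injectivity assumption: a name of a point `x` of `X`
consists of a name of `x` in `X_R` and a name of `x` in `X_S`, and two points of `X` are identified
iff they agree both in `X_R` and in `X_S`. -/
def cutMeet (X : RepSpace α) (R S : α → α → Prop) : RepSpace (Set α × Set α) :=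
  ((X.cutSpace R).prod (X.cutSpace S)).restrict ((fun x => (X.cut R x, X.cut S x)) '' X.carrier)

theorem cut_injOn (X : RepSpace α) (R : α → α → Prop) (irr : ∀ x, ¬ R x x)
    (tri : ∀ x y, R x y ∨ x = y ∨ R y x) : Set.InjOn (X.cut R) X.carrier := by
  intro x hx y hy h
  rcases tri x y with hh | hh | hh
  · have : x ∈ X.cut R x := by rw [h]; exact ⟨hx, hh⟩
    exact absurd this.2 (irr x)
  · exact hh
  · have : y ∈ X.cut R y := by rw [← h]; exact ⟨hy, hh⟩
    exact absurd this.2 (irr y)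

/-- The union of the intervals given by a sequence of pairs of points. -/
def intervalUnion (X : RepSpace α) (prec : α → α → Prop)
    (s : natSpace.carrier → (X.prod X).carrier) : Set α :=
  {x | x ∈ X.carrier ∧ ∃ i, prec (s i : α × α).1 x ∧ prec x (s i : α × α).2}

/-- The intervals of `prec` are an effective base of `O(X)` (relative to the oracle `o`): the
map from `C(ℕ, X × X)` to `O(X)` that takes the union of a sequence of intervals is surjective, and
it has a multivalued right inverse that is computable relative to `o`. -/
structure IntervalBaseIn (o : Baire) (X : RepSpace α) (prec : α → α → Prop) : Prop where
  surjective : ∀ U ∈ X.opens.carrier,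
    ∃ s ∈ (funSpace natSpace (X.prod X)).carrier, X.intervalUnion prec s = U
  rightInverse : ComputableMultiIn o X.opens (funSpace natSpace (X.prod X))
    fun U => {s | X.intervalUnion prec s = U}

/-- `X` is compact: the map that tests an open set for being all of `X` is continuous, that is,
computable relative to some oracle. -/
def IsCompactSpace (X : RepSpace α) : Prop :=
  ∃ o, ComputableMapIn o X.opens sierp fun U => ⟨(U : Set α) = X.carrier, mem_sierp _⟩

/-- The saturation of `A`: the intersection of all open sets that contain `A`. -/
def saturation (X : RepSpace α) (A : Set α) : Set α :=
  {x | x ∈ X.carrier ∧ ∀ U ∈ X.opens.carrier, A ⊆ U → x ∈ U}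

/-- The closure of `A` in the topology of open sets of `X`. -/
def closureIn (X : RepSpace α) (A : Set α) : Set α :=
  {x | x ∈ X.carrier ∧ ∀ U ∈ X.opens.carrier, x ∈ U → (U ∩ A).Nonempty}

/-- The space `K(X)` of saturated compact subsets of `X`, where a set `A` is identified with the
element `{U | A ⊆ U}` of `O(O(X))`. -/
def compacts (X : RepSpace α) : RepSpace (Set α) where
  Names p A := A ⊆ X.carrier ∧ (X.restrict A).IsCompactSpace ∧ X.saturation A = A ∧
    X.opens.opens.Names p {U | U ∈ X.opens.carrier ∧ A ⊆ U}
  functional := by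
    rintro p A B ⟨hA, -, hsA, hpA⟩ ⟨hB, -, hsB, hpB⟩
    have h := X.opens.opens.functional hpA hpB
    have key : ∀ U ∈ X.opens.carrier, (A ⊆ U ↔ B ⊆ U) := fun U hU =>
      ⟨fun hh => (h.subset ⟨hU, hh⟩ : _ ∧ _).2, fun hh => (h.superset ⟨hU, hh⟩ : _ ∧ _).2⟩
    rw [← hsA, ← hsB]
    ext x
    exact and_congr_right fun _ => forall₂_congr fun U hU => imp_congr_left (key U hU)

/-- The space `V(X)` of overt subsets of `X`: for `A ⊆ X`, the element `{U | U ∩ A ≠ ∅}` of `O(O(X))`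
is identified with the closure of `A`. -/
def overts (X : RepSpace α) : RepSpace (Set α) where
  Names p B := ∃ A ⊆ X.carrier, X.closureIn A = B ∧
    X.opens.opens.Names p {U | U ∈ X.opens.carrier ∧ (U ∩ A).Nonempty}
  functional := by
    rintro p B B' ⟨A, hA, rfl, hp⟩ ⟨A', hA', rfl, hp'⟩
    have h := X.opens.opens.functional hp hp'
    have key : ∀ U ∈ X.opens.carrier, ((U ∩ A).Nonempty ↔ (U ∩ A').Nonempty) := fun U hU =>
      ⟨fun hh => (h.subset ⟨hU, hh⟩ : _ ∧ _).2, fun hh => (h.superset ⟨hU, hh⟩ : _ ∧ _).2⟩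
    ext x
    exact and_congr_right fun _ => forall₂_congr fun U hU => imp_congr_right fun _ => key U hU

/-- A standard numbering of the rationals. -/
def ratOf (n : ℕ) : ℚ :=
  ((n.unpair.1.unpair.1 : ℚ) - (n.unpair.1.unpair.2 : ℚ)) / ((n.unpair.2 : ℚ) + 1)

/-- The space of real numbers: a name of `x` is a sequence of rationals whose `n`-th entry has
distance less than `2 ^ (-n)` to `x`. -/
noncomputable def realSpace : RepSpace ℝ where
  Names p x := ∀ n : ℕ, dist ((ratOf (p n) : ℚ) : ℝ) x < (1 / 2 : ℝ) ^ n
  functional := by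
    intro p x y hx hy
    refine eq_of_forall_dist_le fun ε hε => ?_
    obtain ⟨n, hn⟩ := exists_pow_lt_of_lt_one (half_pos hε) (by norm_num : (1 / 2 : ℝ) < 1)
    have h := dist_triangle_left x y ((ratOf (p n) : ℚ) : ℝ)
    linarith [hx n, hy n]

/-- The space `ℝ_<`. -/
noncomputable def realLower : RepSpace ℝ :=
  realSpace.cutPoints (fun x y => x < y)
    (realSpace.cut_injOn _ (fun x => lt_irrefl x) fun x y => lt_trichotomy x y)

/-- The space `ℝ_>`. -/
noncomputable def realUpper : RepSpace ℝ :=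
  realSpace.cutPoints (fun x y => x > y)
    (realSpace.cut_injOn _ (fun x => lt_irrefl x) fun x y => (lt_trichotomy y x).imp id (Or.imp_left Eq.symm))

end RepSpace

/-! For the first claim, let `U` be open and name it by a sequence of intervals `(a i, b i)` with
union `U`. Then `x ∈ U` iff for some `i` the point `a i` lies in the lower cut of `x` and `b i` in
the upper cut. So names of the two cuts suffice to accept exactly the neighborhoods of `x`.
Conversely, `y ≺ x` holds iff the open set `{z | y ≺ z}` belongs to `κ(x)`, and that set is
computable from `y`; the upper cut is symmetric. The two machines are `exists_machine_cuts_kappa`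
and `exists_machine_kappa_cuts`. `kappa_eq_iff` shows that both sides identify the same points, so
that the machines realize a bijection.

For the reals, a rational `c` is within `2 ^ (-k)` of `x` iff `c - 2 ^ (-k) < x < c + 2 ^ (-k)`.
Given both cuts this is semidecidable, and a search finds such a `c` for every `k`. The same search
computes a maximum: `max A < r` iff `A` is contained in the ray below `r`, which the name in `K`
confirms, and `r < max A` iff the ray above `r` meets `A`, which the name in `V` confirms. The
maximum exists because a machine accepts a cover by left rays after reading finitely many of them,
so one ray of the cover already contains `A` (`exists_subset_Iio`).

All machines come from one notion, `SemiDec`: a predicate of a tape that is witnessed by a primitive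
recursive test of a finite initial segment. It is closed under the logical operations and under
substitution of computed tapes, and it contains the universal predicate `MachineWrites`. The lemmas
`exists_machine_select` and `SemiDec.exists_names_opens` turn such predicates back into machines and
into names of open sets. -/

open Nat.Partrec (Code)
open Primrec (fst snd)

/-! ### Bounded quantifiers and initial segments -/

namespace PrimrecRel

variable {β : Type*} [Primcodable β] {R : ℕ → β → Prop}

theorem bounded_exists (hR : PrimrecRel R) : PrimrecRel fun n b => ∃ i < n, R i b :=
  (hR.exists_mem_list.comp (Primrec.list_range.comp fst) snd).of_eq (by simp)

theorem bounded_forall (hR : PrimrecRel R) : PrimrecRel fun n b => ∀ i < n, R i b :=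
  (hR.forall_mem_list.comp (Primrec.list_range.comp fst) snd).of_eq (by simp)

end PrimrecRel

namespace Baire

@[simp]
theorem length_take (r : Baire) (m : ℕ) : (r.take m).length = m := by simp [take]

theorem getElem?_take (r : Baire) (m i : ℕ) :
    (r.take m)[i]? = if i < m then some (r i) else none := by
  by_cases h : i < m <;> simp [take, h]

theorem take_take (r : Baire) {m m' : ℕ} (h : m ≤ m') : (r.take m').take m = r.take m := by
  simp [take, ← List.map_take, List.take_range, min_eq_left h]

theorem take_congr {r s : Baire} {m : ℕ} (h : ∀ i < m, r i = s i) : r.take m = s.take m :=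
  List.map_congr_left fun i hi => h i (List.mem_range.1 hi)

/-- The sequence with first entry `e` and the entries of `r` after it. -/
def cons (e : ℕ) (r : Baire) : Baire := fun i => if i = 0 then e else r (i - 1)

@[simp]
theorem fst_pair (p q : Baire) : (pair p q).fst = p := by
  funext n
  simp [fst, pair]

@[simp]
theorem snd_pair (p q : Baire) : (pair p q).snd = q := by
  funext n
  have h : (2 * n + 1) / 2 = n := by omega
  simp [snd, pair, Nat.add_mod, h]

end Baire

/-! ### Semidecidable predicates of a tape -/

/-- The predicate `P` of a tape and a parameter is semidecidable, uniformly in both: it holds iff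
some initial segment of the tape passes a primitive recursive test. -/
def SemiDec {β : Type} [Primcodable β] (P : Baire → β → Prop) : Prop :=
  ∃ D : List ℕ → β → Prop, PrimrecRel D ∧ ∀ r b, P r b ↔ ∃ m, D (r.take m) b

namespace SemiDec

variable {β γ : Type} [Primcodable β] [Primcodable γ] {P Q : Baire → β → Prop}

theorem of_eq (hP : SemiDec P) (h : ∀ r b, P r b ↔ Q r b) : SemiDec Q := by
  obtain ⟨D, hD, hPD⟩ := hP
  exact ⟨D, hD, fun r b => (h r b).symm.trans (hPD r b)⟩

/-- A semidecidable predicate has a test that stays true on longer initial segments. -/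
theorem exists_monotone (hP : SemiDec P) : ∃ D : List ℕ → β → Prop, PrimrecRel D ∧
    (∀ r b, P r b ↔ ∃ m, D (r.take m) b) ∧
    ∀ r b m m', m ≤ m' → D (Baire.take r m) b → D (Baire.take r m') b := by
  obtain ⟨D, hD, h⟩ := hP
  refine ⟨fun σ b => ∃ i < σ.length + 1, D (σ.take i) b, ?_, fun r b => ?_, ?_⟩
  · have h1 : PrimrecRel fun (i : ℕ) (x : List ℕ × β) => D (x.1.take i) x.2 :=
      hD.comp (Primrec.list_take.comp fst (fst.comp snd)) (snd.comp snd)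
    exact h1.bounded_exists.comp (Primrec.succ.comp (Primrec.list_length.comp fst)) Primrec.id
  · rw [h]
    constructor
    · rintro ⟨m, hm⟩
      exact ⟨m, m, by simp, by rwa [r.take_take le_rfl]⟩
    · rintro ⟨m, i, hi, hD'⟩
      rw [Baire.length_take] at hi
      rw [r.take_take (by omega)] at hD'
      exact ⟨i, hD'⟩
  · rintro r b m m' hm ⟨i, hi, hD'⟩
    rw [Baire.length_take] at hi
    rw [r.take_take (by omega)] at hD'
    exact ⟨i, by rw [Baire.length_take]; omega, by rwa [r.take_take (by omega)]⟩

theorem of_primrecPred {p : β → Prop} (hp : PrimrecPred p) : SemiDec fun _ b => p b :=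
  ⟨fun _ b => p b, hp.comp snd, fun _ _ => by simp⟩

/-- Reading the tape. -/
theorem read : SemiDec fun r (x : ℕ × ℕ) => r x.1 = x.2 := by
  refine ⟨fun σ x => σ[x.1]? = some x.2, ?_, fun r x => ?_⟩
  · exact Primrec.eq.comp (Primrec.list_getElem?.comp fst (fst.comp snd))
      (Primrec.option_some.comp (snd.comp snd))
  · constructor
    · intro h
      exact ⟨x.1 + 1, by
        change (r.take (x.1 + 1))[x.1]? = some x.2
        rw [Baire.getElem?_take, if_pos (Nat.lt_succ_self _), h]⟩
    · rintro ⟨m, hm⟩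
      rw [Baire.getElem?_take] at hm
      split_ifs at hm
      exact Option.some_injective _ hm

theorem comp {P : Baire → γ → Prop} (hP : SemiDec P) {f : β → γ} (hf : Primrec f) :
    SemiDec fun r b => P r (f b) := by
  obtain ⟨D, hD, h⟩ := hP
  exact ⟨fun σ b => D σ (f b), hD.comp fst (hf.comp snd), fun r b => h r (f b)⟩

theorem and (hP : SemiDec P) (hQ : SemiDec Q) : SemiDec fun r b => P r b ∧ Q r b := by
  obtain ⟨D, hD, h, hm⟩ := hP.exists_monotone
  obtain ⟨E, hE, h', hm'⟩ := hQ.exists_monotone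
  refine ⟨fun σ b => D σ b ∧ E σ b, PrimrecPred.and hD hE, fun r b => ?_⟩
  refine (and_congr (h r b) (h' r b)).trans ?_
  constructor
  · rintro ⟨⟨m, h1⟩, m', h2⟩
    exact ⟨max m m', hm _ _ _ _ (le_max_left _ _) h1, hm' _ _ _ _ (le_max_right _ _) h2⟩
  · rintro ⟨m, h1, h2⟩
    exact ⟨⟨m, h1⟩, m, h2⟩

theorem or (hP : SemiDec P) (hQ : SemiDec Q) : SemiDec fun r b => P r b ∨ Q r b := by
  obtain ⟨D, hD, h⟩ := hP
  obtain ⟨E, hE, h'⟩ := hQ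
  refine ⟨fun σ b => D σ b ∨ E σ b, PrimrecPred.or hD hE, fun r b => ?_⟩
  exact (or_congr (h r b) (h' r b)).trans exists_or.symm

theorem ite {c : β → Prop} [DecidablePred c] (hc : PrimrecPred c) (hP : SemiDec P)
    (hQ : SemiDec Q) : SemiDec fun r b => if c b then P r b else Q r b := by
  refine (((of_primrecPred hc).and hP).or ((of_primrecPred hc.not).and hQ)).of_eq fun r b => ?_
  by_cases h : c b <;> simp [h]

theorem ex {P : Baire → β → γ → Prop}
    (hP : SemiDec fun r (x : β × γ) => P r x.1 x.2) : SemiDec fun r b => ∃ c, P r b c := by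
  obtain ⟨D, hD, h, hm⟩ := hP.exists_monotone
  have h' := fun r b c => h r (b, c)
  simp only at h'
  -- The length of the segment also bounds the search for `c`. Monotonicity of `D` is needed because
  -- the segment may have to be lengthened until it exceeds the code of `c`.
  refine ⟨fun σ b => ∃ n < σ.length, ∃ c ∈ (Encodable.decode (α := γ) n).toList, D σ (b, c), ?_,
    fun r b => ?_⟩
  · have h1 : PrimrecRel fun (c : γ) (x : List ℕ × β) => D x.1 (x.2, c) :=
      hD.comp (fst.comp snd) ((snd.comp snd).pair fst)
    have h2 : PrimrecRel fun (n : ℕ) (x : List ℕ × β) =>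
        ∃ c ∈ (Encodable.decode (α := γ) n).toList, D x.1 (x.2, c) :=
      h1.exists_mem_list.comp (Primrec.optionToList.comp (Primrec.decode.comp fst)) snd
    exact h2.bounded_exists.comp (Primrec.list_length.comp fst) Primrec.id
  · simp only [h']
    constructor
    · rintro ⟨c, m, hD'⟩
      refine ⟨max m (Encodable.encode c + 1), Encodable.encode c, by simp, c, by simp, ?_⟩
      exact hm _ _ _ _ (le_max_left _ _) hD'
    · rintro ⟨m, n, -, c, -, hD'⟩
      exact ⟨c, m, hD'⟩

theorem forall_lt {P : Baire → β → ℕ → Prop} (hP : SemiDec fun r (x : β × ℕ) => P r x.1 x.2)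
    {f : β → ℕ} (hf : Primrec f) : SemiDec fun r b => ∀ i < f b, P r b i := by
  obtain ⟨D, hD, h, hm⟩ := hP.exists_monotone
  have h' := fun r b c => h r (b, c)
  simp only at h'
  refine ⟨fun σ b => ∀ i < f b, D σ (b, i), ?_, fun r b => ?_⟩
  · have h1 : PrimrecRel fun (i : ℕ) (x : List ℕ × β) => D x.1 (x.2, i) :=
      hD.comp (fst.comp snd) ((snd.comp snd).pair fst)
    exact h1.bounded_forall.comp (hf.comp snd) Primrec.id
  · simp only [h']
    constructor
    · intro hi
      choose! m hm' using hi
      -- Finitely many tests pass simultaneously on the longest of their segments, again by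
      -- monotonicity.
      exact ⟨(Finset.range (f b)).sup m, fun i hi =>
        hm _ _ _ _ (Finset.le_sup (Finset.mem_range.2 hi)) (hm' i hi)⟩
    · rintro ⟨m, hD'⟩ i hi
      exact ⟨m, hD' i hi⟩

/-- Semidecidable predicates of a computed tape: where the relation `G` is the graph of a sequence,
the predicate `P` of that sequence is semidecidable. -/
theorem exists_subst {P : Baire → γ → Prop} (hP : SemiDec P) {g : β → γ} (hg : Primrec g)
    {G : Baire → β → ℕ → ℕ → Prop} (hG : SemiDec fun r (x : β × ℕ × ℕ) => G r x.1 x.2.1 x.2.2) :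
    ∃ Q : Baire → β → Prop, SemiDec Q ∧
      ∀ r b s, (∀ i v, G r b i v ↔ s i = v) → (Q r b ↔ P s (g b)) := by
  obtain ⟨D, hD, h⟩ := hP
  -- `Q` guesses an initial segment `σ` of the computed sequence, verifies each entry through `G`,
  -- and then tests `σ`. It makes sense for every `G`; that `G` is the graph of a total sequence
  -- matters only for the equivalence. This allows sequences that are computed by machines which may
  -- diverge on other tapes.
  refine ⟨fun r b => ∃ σ : List ℕ, (∀ i < σ.length, ∃ v, σ[i]? = some v ∧ G r b i v) ∧ D σ (g b),
    ?_, fun r b s hs => ?_⟩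
  · have h1 : SemiDec fun (_ : Baire) (x : ((β × List ℕ) × ℕ) × ℕ) =>
        x.1.1.2[x.1.2]? = some x.2 :=
      of_primrecPred (Primrec.eq.comp (Primrec.list_getElem?.comp (snd.comp (fst.comp fst))
        (snd.comp fst)) (Primrec.option_some.comp snd))
    have h2 : SemiDec fun r (x : ((β × List ℕ) × ℕ) × ℕ) => G r x.1.1.1 x.1.2 x.2 :=
      hG.comp (f := fun x : ((β × List ℕ) × ℕ) × ℕ => (x.1.1.1, x.1.2, x.2))
        ((fst.comp (fst.comp fst)).pair ((snd.comp fst).pair snd))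
    have h3 : SemiDec fun r (x : (β × List ℕ) × ℕ) =>
        ∃ v, x.1.2[x.2]? = some v ∧ G r x.1.1 x.2 v :=
      SemiDec.ex (P := fun r (x : (β × List ℕ) × ℕ) v => x.1.2[x.2]? = some v ∧ G r x.1.1 x.2 v)
        (h1.and h2)
    have h4 : SemiDec fun r (x : β × List ℕ) =>
        ∀ i < x.2.length, ∃ v, x.2[i]? = some v ∧ G r x.1 i v :=
      SemiDec.forall_lt (P := fun r (x : β × List ℕ) i => ∃ v, x.2[i]? = some v ∧ G r x.1 i v) h3
        (Primrec.list_length.comp snd)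
    exact SemiDec.ex (P := fun r b (σ : List ℕ) =>
      (∀ i < σ.length, ∃ v, σ[i]? = some v ∧ G r b i v) ∧ D σ (g b))
      (h4.and (of_primrecPred (hD.comp snd (hg.comp fst))))
  · rw [h]
    constructor
    · rintro ⟨σ, hσ, hD'⟩
      refine ⟨σ.length, ?_⟩
      have : s.take σ.length = σ := by
        apply List.ext_getElem?
        intro i
        rw [Baire.getElem?_take]
        split_ifs with hi
        · obtain ⟨v, hv, hGv⟩ := hσ i hi
          rw [hv, (hs i v).1 hGv]
        · simp at hi
          simp [hi]
      rwa [this]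
    · rintro ⟨m, hD'⟩
      refine ⟨s.take m, fun i hi => ⟨s i, ?_, (hs i _).2 rfl⟩, hD'⟩
      rw [Baire.length_take] at hi
      rw [Baire.getElem?_take, if_pos hi]

end SemiDec

/-! ### Sequences computed from a tape -/

/-- The graph of `F`, which computes a sequence from a tape and a parameter, is semidecidable. -/
def ComputableSeq {β : Type} [Primcodable β] (F : Baire → β → Baire) : Prop :=
  SemiDec fun r (x : β × ℕ × ℕ) => F r x.1 x.2.1 = x.2.2

namespace ComputableSeq

variable {β γ : Type} [Primcodable β] [Primcodable γ] {F G : Baire → β → Baire}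

theorem id : ComputableSeq fun r (_ : β) => r := SemiDec.read.comp snd

theorem comp {F : Baire → γ → Baire} (hF : ComputableSeq F) {f : β → γ} (hf : Primrec f) :
    ComputableSeq fun r b => F r (f b) :=
  SemiDec.comp hF ((hf.comp fst).pair snd)

theorem const {f : β → ℕ} (hf : Primrec f) : ComputableSeq fun _ b _ => f b :=
  SemiDec.of_primrecPred (Primrec.eq.comp (hf.comp fst) (snd.comp snd))

theorem reindex (hF : ComputableSeq F) {f : ℕ → ℕ} (hf : Primrec f) :
    ComputableSeq fun r b i => F r b (f i) :=
  SemiDec.comp hF (fst.pair ((hf.comp (fst.comp snd)).pair (snd.comp snd)))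

protected theorem fst (hF : ComputableSeq F) : ComputableSeq fun r b => (F r b).fst :=
  hF.reindex Primrec.nat_double

protected theorem snd (hF : ComputableSeq F) : ComputableSeq fun r b => (F r b).snd :=
  hF.reindex Primrec.nat_double_succ

theorem tail (hF : ComputableSeq F) : ComputableSeq fun r b => (F r b).tail :=
  hF.reindex Primrec.succ

theorem cons (hF : ComputableSeq F) (e : ℕ) : ComputableSeq fun r b => (F r b).cons e := by
  have h : SemiDec fun (_ : Baire) (x : β × ℕ × ℕ) => e = x.2.2 :=
    SemiDec.of_primrecPred (Primrec.eq.comp (Primrec.const e) (snd.comp snd))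
  refine (SemiDec.ite (c := fun x : β × ℕ × ℕ => x.2.1 = 0)
    (Primrec.eq.comp (fst.comp snd) (Primrec.const 0)) h
    (hF.reindex Primrec.pred)).of_eq fun r x => ?_
  by_cases h0 : x.2.1 = 0 <;> simp [Baire.cons, h0]

end ComputableSeq

namespace SemiDec

variable {β γ : Type} [Primcodable β] [Primcodable γ]

theorem graph_pair {G H : Baire → β → ℕ → ℕ → Prop}
    (hG : SemiDec fun r (x : β × ℕ × ℕ) => G r x.1 x.2.1 x.2.2)
    (hH : SemiDec fun r (x : β × ℕ × ℕ) => H r x.1 x.2.1 x.2.2) :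
    SemiDec fun r (x : β × ℕ × ℕ) =>
      if x.2.1 % 2 = 0 then G r x.1 (x.2.1 / 2) x.2.2 else H r x.1 (x.2.1 / 2) x.2.2 := by
  have hf : Primrec fun x : β × ℕ × ℕ => (x.1, x.2.1 / 2, x.2.2) :=
    fst.pair ((Primrec.nat_div.comp (fst.comp snd) (Primrec.const 2)).pair (snd.comp snd))
  exact ite (c := fun x : β × ℕ × ℕ => x.2.1 % 2 = 0)
    (Primrec.eq.comp (Primrec.nat_mod.comp (fst.comp snd) (Primrec.const 2)) (Primrec.const 0))
    (hG.comp hf) (hH.comp hf)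

theorem subst {P : Baire → γ → Prop} (hP : SemiDec P) {F : Baire → β → Baire}
    (hF : ComputableSeq F) {g : β → γ} (hg : Primrec g) : SemiDec fun r b => P (F r b) (g b) := by
  obtain ⟨Q, hQ, h⟩ := hP.exists_subst (G := fun r b i v => F r b i = v) hg hF
  exact hQ.of_eq fun r b => h r b (F r b) fun _ _ => Iff.rfl

theorem entry_eq {F : Baire → β → Baire} (hF : ComputableSeq F) {f g : β → ℕ} (hf : Primrec f)
    (hg : Primrec g) : SemiDec fun r b => F r b (f b) = g b :=
  SemiDec.comp hF (Primrec.id.pair (hf.pair hg))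

end SemiDec

theorem ComputableSeq.pair {β : Type} [Primcodable β] {F G : Baire → β → Baire}
    (hF : ComputableSeq F) (hG : ComputableSeq G) :
    ComputableSeq fun r b => (F r b).pair (G r b) := by
  refine (SemiDec.graph_pair (G := fun r b i v => F r b i = v)
    (H := fun r b i v => G r b i = v) hF hG).of_eq fun r x => ?_
  by_cases h : x.2.1 % 2 = 0 <;> simp [Baire.pair, h]

/-! ### From machines to semidecidable predicates and back -/

theorem MachineWrites.unique {e : ℕ} {r : Baire} {k v v' : ℕ} (h : MachineWrites e r k v)
    (h' : MachineWrites e r k v') : v = v' := by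
  obtain ⟨m, hm, hlt⟩ := h
  obtain ⟨m', hm', hlt'⟩ := h'
  rcases lt_trichotomy m m' with hh | rfl | hh
  · exact absurd (Part.mem_unique hm (hlt' m hh)) (Nat.succ_ne_zero _)
  · exact Nat.succ_injective (Part.mem_unique hm hm')
  · exact absurd (Part.mem_unique hm' (hlt m' hh)) (Nat.succ_ne_zero _)

/-- A computation that writes an entry reads finitely many places and takes finitely many steps. The
length of the inspected segment serves as a bound for both, by way of the step-bounded evaluation
`evaln`. -/
theorem semiDec_machineWrites :
    SemiDec fun r (x : ℕ × ℕ × ℕ) => MachineWrites x.1 r x.2.1 x.2.2 := by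
  let A : ℕ → List ℕ → ℕ → ℕ → ℕ → Option ℕ := fun s σ e k m =>
    (Denumerable.ofNat Code e).evaln s (Nat.pair (Encodable.encode (σ.take m)) k)
  refine ⟨fun σ x => ∃ m < σ.length + 1, A σ.length σ x.1 x.2.1 m = some (x.2.2 + 1) ∧
    ∀ j < m, A σ.length σ x.1 x.2.1 j = some 0, ?_, fun r x => ?_⟩
  · have hA : Primrec fun y : ℕ × List ℕ × ℕ × ℕ × ℕ =>
        A y.2.1.length y.2.1 y.2.2.1 y.2.2.2.1 y.1 :=
      Code.primrec_evaln.comp (((Primrec.list_length.comp (fst.comp snd)).pair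
        ((Primrec.ofNat Code).comp (fst.comp (snd.comp snd)))).pair
        (Primrec₂.natPair.comp (Primrec.encode.comp (Primrec.list_take.comp fst (fst.comp snd)))
          (fst.comp (snd.comp (snd.comp snd)))))
    have h0 : PrimrecRel fun (j : ℕ) (y : List ℕ × ℕ × ℕ × ℕ) =>
        A y.1.length y.1 y.2.1 y.2.2.1 j = some 0 :=
      Primrec.eq.comp hA (Primrec.const (some 0))
    have h1 : PrimrecRel fun (m : ℕ) (y : List ℕ × ℕ × ℕ × ℕ) =>
        A y.1.length y.1 y.2.1 y.2.2.1 m = some (y.2.2.2 + 1) :=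
      Primrec.eq.comp hA (Primrec.option_some.comp
        (Primrec.succ.comp (snd.comp (snd.comp (snd.comp snd)))))
    have h2 := PrimrecRel.bounded_exists (R := fun (m : ℕ) (y : List ℕ × ℕ × ℕ × ℕ) =>
        A y.1.length y.1 y.2.1 y.2.2.1 m = some (y.2.2.2 + 1) ∧
          ∀ j < m, A y.1.length y.1 y.2.1 y.2.2.1 j = some 0) (PrimrecPred.and h1
          (h0.bounded_forall.comp fst snd))
    exact h2.comp (Primrec.succ.comp (Primrec.list_length.comp fst)) Primrec.id
  · obtain ⟨e, k, v⟩ := x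
    simp only [Baire.length_take]
    constructor
    · rintro ⟨m, hm, hlt⟩
      have hlt' : ∀ j < m, ∃ s, A s (r.take m) e k j = some 0 := by
        intro j hj
        obtain ⟨s, hs⟩ := Code.evaln_complete.1 (hlt j hj)
        refine ⟨s, ?_⟩
        simp only [A, r.take_take hj.le]
        exact hs
      choose! s hs using hlt'
      obtain ⟨s', hs'⟩ := Code.evaln_complete.1 hm
      -- `M` exceeds the number of places read and the steps needed for the final answer and for all
      -- earlier requests to read on.
      let M := max m (max s' ((Finset.range m).sup s))
      have hM : m ≤ M := le_max_left _ _
      refine ⟨M, m, by omega, ?_, fun j hj => ?_⟩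
      · simp only [A, r.take_take hM]
        exact Code.evaln_mono ((le_max_left _ _).trans (le_max_right _ _)) hs'
      · have := hs j hj
        simp only [A, r.take_take hj.le] at this
        simp only [A, r.take_take (hj.le.trans hM)]
        exact Code.evaln_mono (((Finset.le_sup (Finset.mem_range.2 hj)).trans
          (le_max_right _ _)).trans (le_max_right _ _)) this
    · rintro ⟨s, m, hm, h1, h2⟩
      refine ⟨m, ?_, fun j hj => ?_⟩
      · simp only [A, r.take_take (show m ≤ s by omega)] at h1
        exact Code.evaln_sound h1
      · have := h2 j hj
        simp only [A, r.take_take (show j ≤ s by omega)] at this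
        exact Code.evaln_sound this

/-- A primitive recursive function of the part read so far gives the answers of a machine. -/
theorem exists_machineAnswer {g : List ℕ → ℕ → ℕ} (hg : Primrec₂ g) :
    ∃ e, ∀ r m k, machineAnswer e r m k = Part.some (g (r.take m) k) := by
  have h : Primrec fun n : ℕ => g (Denumerable.ofNat (List ℕ) n.unpair.1) n.unpair.2 :=
    hg.comp ((Primrec.ofNat _).comp (fst.comp Primrec.unpair)) (snd.comp Primrec.unpair)
  obtain ⟨c, hc⟩ := Code.exists_code.1 (Partrec.nat_iff.1 h.to_comp.partrec)
  refine ⟨Encodable.encode c, fun r m k => ?_⟩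
  simp [machineAnswer, hc]

/-- A machine that selects elements of the nonempty sections of a semidecidable relation. -/
theorem exists_machine_select {G : Baire → ℕ → ℕ → Prop}
    (hG : SemiDec fun r (x : ℕ × ℕ) => G r x.1 x.2) :
    ∃ e, ∀ r, (∀ k, ∃ v, G r k v) →
      ∃ q : Baire, (∀ k, MachineWrites e r k (q k)) ∧ ∀ k, G r k (q k) := by
  classical
  obtain ⟨D, hD, h, hm⟩ := hG.exists_monotone
  have h' := fun r b c => h r (b, c)
  simp only at h'
  -- The first candidate below the length of the segment that passes the test. If there is none,
  -- `findIdx` returns the length, which makes the machine below answer `0` and read on.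
  let I : List ℕ → ℕ → ℕ := fun σ k => (List.range σ.length).findIdx fun v => decide (D σ (k, v))
  have hI : Primrec₂ I := by
    refine Primrec.list_findIdx (Primrec.list_range.comp (Primrec.list_length.comp fst)) ?_
    exact (hD.comp (fst.comp fst) ((snd.comp fst).pair snd)).decide
  obtain ⟨e, he⟩ := exists_machineAnswer (g := fun σ k => if I σ k < σ.length then I σ k + 1 else 0)
    (Primrec.ite (Primrec.nat_lt.comp hI (Primrec.list_length.comp fst)) (Primrec.succ.comp hI)
      (Primrec.const 0))
  refine ⟨e, fun r hr => ?_⟩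
  have key : ∀ k, ∃ v, MachineWrites e r k v ∧ G r k v := by
    intro k
    have hex : ∃ m, I (r.take m) k < m := by
      obtain ⟨v, hv⟩ := hr k
      obtain ⟨m, hmD⟩ := (h' _ _ _).1 hv
      -- The segment must be long enough for the test to accept `v` and also for `v` to lie in the
      -- range that is searched.
      refine ⟨max m (v + 1), ?_⟩
      simp only [I, Baire.length_take]
      refine (List.findIdx_lt_length_of_exists ⟨v, by simp, ?_⟩).trans_eq (List.length_range)
      exact decide_eq_true (hm _ _ _ _ (le_max_left _ _) hmD)
    refine ⟨I (r.take (Nat.find hex)) k, ⟨Nat.find hex, ?_, fun j hj => ?_⟩, ?_⟩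
    · simp [he, Nat.find_spec hex]
    · simp [he, Nat.find_min hex hj]
    · refine (h' _ _ _).2 ⟨Nat.find hex, ?_⟩
      have hlt := Nat.find_spec hex
      generalize Nat.find hex = m at hlt
      have := List.findIdx_getElem (xs := List.range (r.take m).length)
        (p := fun v => decide (D (r.take m) (k, v))) (w := by simpa [I] using hlt)
      simpa [I] using this
  choose q hq using key
  exact ⟨q, fun k => (hq k).1, fun k => (hq k).2⟩

theorem ComputableSeq.exists_machine {F : Baire → Unit → Baire} (hF : ComputableSeq F) :
    ∃ e, ∀ o p, MachineComputes e o p (F (Baire.pair o p) ()) := by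
  obtain ⟨e, he⟩ := exists_machine_select (G := fun r k v => F r () k = v)
    (SemiDec.entry_eq (hF.comp (Primrec.const ())) fst snd)
  refine ⟨e, fun o p k => ?_⟩
  obtain ⟨q, hq, hF'⟩ := he (Baire.pair o p) fun k => ⟨_, rfl⟩
  rw [hF' k]
  exact hq k

/-- A machine whose output is nonzero iff the semidecidable predicate `P` holds of its tape. -/
theorem SemiDec.exists_machine {P : Baire → Unit → Prop} (hP : SemiDec P) :
    ∃ e, ∀ o p, ∃ q, MachineComputes e o p q ∧ (P (Baire.pair o p) () ↔ q ≠ 0) := by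
  classical
  obtain ⟨D, hD, h⟩ := hP
  -- Entry `k` of the output records whether the test passes on the first `k` places. This is
  -- decidable once exactly `k` places have been read, so the output is total and is zero iff no
  -- test passes.
  have hG : SemiDec fun r (x : ℕ × ℕ) => (if D (r.take x.1) () then 1 else 0) = x.2 := by
    refine ⟨fun σ x => σ.length = x.1 ∧ (if D σ () then 1 else 0) = x.2, ?_, fun r x => ?_⟩
    · refine PrimrecPred.and (Primrec.eq.comp (Primrec.list_length.comp fst) (fst.comp snd)) ?_
      exact Primrec.eq.comp (Primrec.ite (hD.comp fst (Primrec.const ())) (Primrec.const 1)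
        (Primrec.const 0)) (snd.comp snd)
    · simp
  obtain ⟨e, he⟩ := exists_machine_select
    (G := fun r k v => (if D (r.take k) () then 1 else 0) = v) hG
  refine ⟨e, fun o p => ?_⟩
  obtain ⟨q, hq, hq'⟩ := he (Baire.pair o p) fun k => ⟨_, rfl⟩
  refine ⟨q, hq, ?_⟩
  rw [h, Function.ne_iff]
  refine exists_congr fun k => ?_
  rw [← hq' k]
  by_cases hk : D ((Baire.pair o p).take k) () <;> simp [hk]

/-! ### Acceptance by names of open sets -/

/-- Some entry of the output of the machine with number and oracle `w` and input `p` is written and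
nonzero. If `w` names an open set and `p` a point, this says that the point is in the set. -/
def Accepts (w p : Baire) : Prop :=
  ∃ k v, v ≠ 0 ∧ MachineWrites (w 0) (Baire.pair w.tail p) k v

theorem MachineComputes.accepts_iff {e : ℕ} {o p q : Baire} (h : MachineComputes e o p q) :
    Accepts (Baire.cons e o) p ↔ q ≠ 0 := by
  rw [Function.ne_iff]
  constructor
  · rintro ⟨k, v, hv, hw⟩
    obtain rfl := MachineWrites.unique hw (h k)
    exact ⟨k, hv⟩
  · rintro ⟨k, hk⟩
    exact ⟨k, q k, hk, h k⟩

section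

variable {β : Type} [Primcodable β]

/-- The number of the machine is itself an entry of a computed sequence. It is therefore guessed and
verified, and then enters the universal predicate as a parameter. -/
theorem SemiDec.writes {W F : Baire → β → Baire} (hW : ComputableSeq W) (hF : ComputableSeq F)
    {k v : β → ℕ} (hk : Primrec k) (hv : Primrec v) :
    SemiDec fun r b => MachineWrites (W r b 0) (Baire.pair (W r b).tail (F r b)) (k b) (v b) := by
  have h1 : SemiDec fun r (x : β × ℕ) =>
      MachineWrites x.2 (Baire.pair (W r x.1).tail (F r x.1)) (k x.1) (v x.1) :=
    semiDec_machineWrites.subst (F := fun r (x : β × ℕ) => Baire.pair (W r x.1).tail (F r x.1))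
      (((hW.comp fst).tail).pair (hF.comp fst)) (g := fun x : β × ℕ => (x.2, k x.1, v x.1))
      (snd.pair ((hk.comp fst).pair (hv.comp fst)))
  have h2 : SemiDec fun r (x : β × ℕ) => W r x.1 0 = x.2 :=
    SemiDec.entry_eq (hW.comp fst) (Primrec.const 0) snd
  refine (SemiDec.ex (P := fun r b e => W r b 0 = e ∧
    MachineWrites e (Baire.pair (W r b).tail (F r b)) (k b) (v b)) (h2.and h1)).of_eq
    fun r b => ?_
  simp

theorem SemiDec.accepts {W F : Baire → β → Baire} (hW : ComputableSeq W) (hF : ComputableSeq F) :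
    SemiDec fun r b => Accepts (W r b) (F r b) := by
  have h1 : SemiDec fun (_ : Baire) (x : (β × ℕ) × ℕ) => x.2 ≠ 0 :=
    SemiDec.of_primrecPred (Primrec.eq.comp snd (Primrec.const 0)).not
  have h2 : SemiDec fun r (x : (β × ℕ) × ℕ) => MachineWrites (W r x.1.1 0)
      (Baire.pair (W r x.1.1).tail (F r x.1.1)) x.1.2 x.2 :=
    SemiDec.writes (hW.comp (fst.comp fst)) (hF.comp (fst.comp fst)) (snd.comp fst) snd
  have h3 : SemiDec fun r (x : β × ℕ) => ∃ v, v ≠ 0 ∧ MachineWrites (W r x.1 0)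
      (Baire.pair (W r x.1).tail (F r x.1)) x.2 v :=
    SemiDec.ex (P := fun r (x : β × ℕ) v => v ≠ 0 ∧ MachineWrites (W r x.1 0)
      (Baire.pair (W r x.1).tail (F r x.1)) x.2 v) (h1.and h2)
  exact SemiDec.ex (P := fun r b k => ∃ v, v ≠ 0 ∧ MachineWrites (W r b 0)
      (Baire.pair (W r b).tail (F r b)) k v) h3

end

/-! ### Names of open sets and isomorphisms -/

namespace RepSpace

variable {α β : Type*} {X : RepSpace α} {Y : RepSpace β}

theorem mem_carrier {p : Baire} {x : α} (h : X.Names p x) : x ∈ X.carrier := ⟨p, h⟩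

/-- This is the bridge between the two sides of the proof: facts about sets become semidecidable
predicates of names, and the choice of the names is irrelevant. -/
theorem accepts_iff_mem {w p : Baire} {U : Set α} {x : α} (hw : X.opens.Names w U)
    (hp : X.Names p x) : Accepts w p ↔ x ∈ U := by
  obtain ⟨q, hq, y, rfl, hy⟩ := hw.2 p ⟨x, p, hp⟩ hp ⟨_, rfl⟩
  refine Iff.trans ?_ hy.symm
  rw [← hq.accepts_iff]
  have : Baire.cons (w 0) w.tail = w := by
    funext i
    rcases i with _ | i <;> rfl
  rw [this]

/-- The machine of a semidecidable predicate, with an oracle that gives its first argument, is a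
name of the open set that the predicate defines. -/
theorem _root_.SemiDec.exists_names_opens {P : Baire → Unit → Prop} (hP : SemiDec P) :
    ∃ e, ∀ (α : Type*) (X : RepSpace α) (U : Set α) (o : Baire), U ⊆ X.carrier →
      (∀ p x, X.Names p x → (P (Baire.pair o p) () ↔ x ∈ U)) →
      X.opens.Names (Baire.cons e o) U := by
  obtain ⟨e, he⟩ := hP.exists_machine
  refine ⟨e, fun α X U o hU h => ⟨hU, fun p x hp _ => ?_⟩⟩
  obtain ⟨q, hq, hPq⟩ := he o p
  exact ⟨q, hq, _, rfl, ((h p x hp).symm.trans hPq)⟩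

theorem names_opens_of_computableOpenIn {o : Baire} {U : Set α} (hU : U ⊆ X.carrier)
    (h : X.ComputableOpenIn o U) : ∃ w : ℕ, X.opens.Names (Baire.cons w o) U := by
  obtain ⟨e, he⟩ := h
  exact ⟨e, hU, he⟩

theorem names_prod {p q : Baire} {x : α} {y : β} (hp : X.Names p x) (hq : Y.Names q y) :
    (X.prod Y).Names (Baire.pair p q) (x, y) := by
  constructor
  · simpa using hp
  · simpa using hq

theorem names_meet {X' : RepSpace α} {p q : Baire} {x : α} (hp : X.Names p x)
    (hq : X'.Names q x) : (X.meet X').Names (Baire.pair p q) x := by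
  constructor
  · simpa using hp
  · simpa using hq

/-- Two parametrizations by a set `C` that identify the same points, together with machines that
translate the names, give an isomorphism. -/
theorem exists_computableIsoIn {γ : Type*} {o : Baire} {C : Set γ} {a : γ → α} {b : γ → β}
    (hX : X.carrier = a '' C) (hY : Y.carrier = b '' C)
    (hab : ∀ x ∈ C, ∀ y ∈ C, a x = a y ↔ b x = b y) {e e' : ℕ}
    (he : ∀ x ∈ C, ∀ p, X.Names p (a x) → ∃ q, MachineComputes e o p q ∧ Y.Names q (b x))
    (he' : ∀ x ∈ C, ∀ p, Y.Names p (b x) → ∃ q, MachineComputes e' o p q ∧ X.Names q (a x)) :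
    ∃ f : X.carrier ≃ Y.carrier, ComputableIsoIn o X Y f ∧
      ∀ x ∈ C, ∀ k : X.carrier, (k : α) = a x → (f k : β) = b x := by
  have hs : ∀ k : X.carrier, ∃ x ∈ C, a x = k := fun k => (Set.ext_iff.1 hX k).1 k.2
  have ht : ∀ k : Y.carrier, ∃ x ∈ C, b x = k := fun k => (Set.ext_iff.1 hY k).1 k.2
  choose s hsC hs using hs
  choose t htC ht using ht
  -- Both directions go through chosen parameters in `C`; by `hab` the values do not depend on the
  -- choice.
  let f : X.carrier ≃ Y.carrier :=
    { toFun := fun k => ⟨b (s k), by rw [hY]; exact ⟨_, hsC k, rfl⟩⟩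
      invFun := fun k => ⟨a (t k), by rw [hX]; exact ⟨_, htC k, rfl⟩⟩
      left_inv := fun k => Subtype.ext <| by
        rw [← hs k]
        exact (hab _ (htC _) _ (hsC _)).2 (ht _)
      right_inv := fun k => Subtype.ext <| by
        rw [← ht k]
        exact (hab _ (hsC _) _ (htC _)).1 (hs _) }
  refine ⟨f, ⟨⟨e, fun p k hp _ => ?_⟩, e', fun p k hp _ => ?_⟩, fun x hx k hk => ?_⟩
  · obtain ⟨q, hq, hqY⟩ := he (s k) (hsC k) p (by rwa [hs k])
    exact ⟨q, hq, f k, rfl, hqY⟩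
  · obtain ⟨q, hq, hqX⟩ := he' (t k) (htC k) p (by rwa [ht k])
    exact ⟨q, hq, f.symm k, rfl, hqX⟩
  · exact (hab _ (hsC k) _ hx).1 ((hs k).trans hk)

/-- A test whether an interval of a sequence, with the ends in two given open sets, exists. -/
theorem _root_.SemiDec.exists_interval_test (e : ℕ) : ∃ P : Baire → Unit → Prop, SemiDec P ∧
    ∀ (o p q u t : Baire), MachineComputes e o u t →
    ∀ z : ℕ → Baire, (∀ i, MachineComputes (t 0) t.tail (fun _ => i) (z i)) →
      (P (Baire.pair (Baire.pair o (Baire.pair p q)) u) () ↔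
        ∃ i, Accepts p (z i).fst ∧ Accepts q (z i).snd) := by
  have id {β : Type} [Primcodable β] : ComputableSeq fun r (_ : β) => r := ComputableSeq.id
  have h1 : SemiDec fun r (_ : Unit) => Accepts r.fst.fst r.snd.fst ∧ Accepts r.fst.snd r.snd.snd :=
    (SemiDec.accepts id.fst.fst id.snd.fst).and (SemiDec.accepts id.fst.snd id.snd.snd)
  -- Inner substitution: on the tape `⟨⟨p, q⟩, t⟩` with parameter `i`, this is the graph of `⟨⟨p,
  -- q⟩, z i⟩`, where the machine named by `t` computes `z i`.
  have h2 : SemiDec fun r (x : ℕ × ℕ × ℕ) => if x.2.1 % 2 = 0 then r.fst (x.2.1 / 2) = x.2.2 else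
      MachineWrites (r.snd 0) (Baire.pair r.snd.tail fun _ => x.1) (x.2.1 / 2) x.2.2 :=
    SemiDec.graph_pair (G := fun r _ k v => r.fst k = v)
      (H := fun r i k v => MachineWrites (r.snd 0) (Baire.pair r.snd.tail fun _ => i) k v)
      id.fst (SemiDec.writes id.snd (ComputableSeq.const fst) (fst.comp snd) (snd.comp snd))
  obtain ⟨Q, hQ, hQ'⟩ := h1.exists_subst (β := ℕ) (Primrec.const ())
    (G := fun r i k v => if k % 2 = 0 then r.fst (k / 2) = v else
      MachineWrites (r.snd 0) (Baire.pair r.snd.tail fun _ => i) (k / 2) v) h2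
  have h3 : SemiDec fun r (_ : Unit) => ∃ i, Q r i :=
    SemiDec.ex (P := fun r (_ : Unit) i => Q r i) (hQ.comp snd)
  -- Outer substitution: on the tape `⟨⟨o, ⟨p, q⟩⟩, u⟩`, this is the graph of `⟨⟨p, q⟩, t⟩`, where
  -- machine `e` computes `t` from `u`.
  have h4 : SemiDec fun r (x : Unit × ℕ × ℕ) => if x.2.1 % 2 = 0 then r.fst.snd (x.2.1 / 2) = x.2.2
      else MachineWrites e (Baire.pair r.fst.fst r.snd) (x.2.1 / 2) x.2.2 :=
    SemiDec.graph_pair (G := fun r _ k v => r.fst.snd k = v)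
      (H := fun r _ k v => MachineWrites e (Baire.pair r.fst.fst r.snd) k v)
      id.fst.snd (SemiDec.writes (id.fst.fst.cons e) id.snd (fst.comp snd) (snd.comp snd))
  obtain ⟨P, hP, hP'⟩ := h3.exists_subst (β := Unit) Primrec.id
    (G := fun r _ k v => if k % 2 = 0 then r.fst.snd (k / 2) = v
      else MachineWrites e (Baire.pair r.fst.fst r.snd) (k / 2) v) h4
  refine ⟨P, hP, fun o p q u t ht z hz => ?_⟩
  have graph {s t : Baire} {e : ℕ} {r : Baire} (h : ∀ k, MachineWrites e r k (t k)) (k v : ℕ) :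
      (if k % 2 = 0 then s (k / 2) = v else MachineWrites e r (k / 2) v) ↔ s.pair t k = v := by
    unfold Baire.pair
    split_ifs
    · rfl
    · exact ⟨(h _).unique, fun hv => hv ▸ h _⟩
  rw [hP' _ _ ((p.pair q).pair t) (by simpa using graph (s := p.pair q) ht)]
  refine exists_congr fun i => ?_
  rw [hQ' _ _ ((p.pair q).pair (z i)) (by simpa using graph (s := p.pair q) (hz i))]
  simp

/-! ### Neighborhoods and cuts of a point -/

section Interval

variable {prec : α → α → Prop} {o : Baire}

/-- Initial segments and final segments have names that are computable from their ends. -/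
theorem exists_names_cut (W : ℕ) : ∃ d u : ℕ, ∀ (α : Type*) (X : RepSpace α)
    (prec : α → α → Prop) (o : Baire),
    (X.prod X).opens.Names (Baire.cons W o) {z | z ∈ (X.prod X).carrier ∧ prec z.1 z.2} →
    ∀ p x, X.Names p x → X.opens.Names (Baire.cons d (Baire.pair o p)) (X.cut prec x) ∧
      X.opens.Names (Baire.cons u (Baire.pair o p)) (X.cut (fun x y => prec y x) x) := by
  have id : ComputableSeq fun r (_ : Unit) => r := ComputableSeq.id
  obtain ⟨d, hd⟩ := (SemiDec.accepts (id.fst.fst.cons W)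
    (id.snd.pair id.fst.snd)).exists_names_opens
  obtain ⟨u, hu⟩ := (SemiDec.accepts (id.fst.fst.cons W)
    (id.fst.snd.pair id.snd)).exists_names_opens
  refine ⟨d, u, fun α X prec o h p x hp => ⟨hd _ _ _ _ (fun y hy => hy.1) fun q y hq => ?_,
    hu _ _ _ _ (fun y hy => hy.1) fun q y hq => ?_⟩⟩
  · simp only [Baire.fst_pair, Baire.snd_pair]
    rw [accepts_iff_mem h (names_prod hq hp)]
    exact and_congr_left fun _ => ⟨fun _ => mem_carrier hq, fun _ => mem_carrier (names_prod hq hp)⟩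
  · simp only [Baire.fst_pair, Baire.snd_pair]
    rw [accepts_iff_mem h (names_prod hp hq)]
    exact and_congr_left fun _ => ⟨fun _ => mem_carrier hq, fun _ => mem_carrier (names_prod hp hq)⟩

/-- A machine that computes both cuts of a point from its neighborhoods. -/
theorem exists_machine_kappa_cuts
    (h : (X.prod X).ComputableOpenIn o {z | z ∈ (X.prod X).carrier ∧ prec z.1 z.2}) :
    ∃ e, ∀ x ∈ X.carrier, ∀ p, X.opens.opens.Names p (X.kappa x) → ∃ q q',
      MachineComputes e o p (Baire.pair q q') ∧ X.opens.Names q (X.cut prec x) ∧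
      X.opens.Names q' (X.cut (fun x y => prec y x) x) := by
  have id : ComputableSeq fun r (_ : Unit) => r := ComputableSeq.id
  obtain ⟨W, hW⟩ := names_opens_of_computableOpenIn (fun z hz => hz.1) h
  obtain ⟨d, u, hdu⟩ := exists_names_cut W
  have hdu := hdu α X prec o hW
  -- The roles cross over: `y` is in the lower cut of `x` iff the upper cut of `y` is a neighborhood
  -- of `x`, and conversely.
  obtain ⟨d', hd'⟩ := (SemiDec.accepts id.fst.snd
    ((id.fst.fst.pair id.snd).cons u)).exists_names_opens
  obtain ⟨u', hu'⟩ := (SemiDec.accepts id.fst.snd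
    ((id.fst.fst.pair id.snd).cons d)).exists_names_opens
  obtain ⟨e, he⟩ := ((id.cons d').pair (id.cons u')).exists_machine
  refine ⟨e, fun x hx p hp => ⟨_, _, he o p, hd' _ _ _ _ (fun y hy => hy.1) fun q y hq => ?_,
    hu' _ _ _ _ (fun y hy => hy.1) fun q y hq => ?_⟩⟩
  · simp only [Baire.fst_pair, Baire.snd_pair]
    have hc := (hdu q y hq).2
    rw [accepts_iff_mem hp hc]
    exact ⟨fun H => ⟨mem_carrier hq, H.2.2⟩, fun H => ⟨mem_carrier hc, hx, H.2⟩⟩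
  · simp only [Baire.fst_pair, Baire.snd_pair]
    have hc := (hdu q y hq).1
    rw [accepts_iff_mem hp hc]
    exact ⟨fun H => ⟨mem_carrier hq, H.2.2⟩, fun H => ⟨mem_carrier hc, hx, H.2⟩⟩

theorem mem_natSpace (i : ℕ) : i ∈ natSpace.carrier := ⟨fun _ => i, rfl⟩

/-- A machine that computes the neighborhoods of a point from its cuts. -/
theorem exists_machine_cuts_kappa (h : X.IntervalBaseIn o prec) :
    ∃ e, ∀ x ∈ X.carrier, ∀ p, X.opens.Names p.fst (X.cut prec x) →
      X.opens.Names p.snd (X.cut (fun x y => prec y x) x) → ∃ q,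
      MachineComputes e o p q ∧ X.opens.opens.Names q (X.kappa x) := by
  obtain ⟨b, hb⟩ := h.rightInverse
  obtain ⟨P, hP, hP'⟩ := SemiDec.exists_interval_test b
  obtain ⟨c, hc⟩ := hP.exists_names_opens
  obtain ⟨e, he⟩ := (ComputableSeq.id.cons c).exists_machine
  refine ⟨e, fun x hx p hp hp' => ⟨_, he o p, hc _ _ _ _ (fun U hU => hU.1) fun u U hu => ?_⟩⟩
  have hU := mem_carrier hu
  obtain ⟨s₀, hs₀, hs₀U⟩ := h.surjective U hU
  -- The sequence of intervals may depend on the name `u` of `U`. This is harmless, since only its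
  -- union matters for acceptance.
  obtain ⟨t, ht, s, hs, hts⟩ := hb u ⟨U, hU⟩ hu ⟨⟨s₀, hs₀⟩, hs₀U⟩
  have hs : X.intervalUnion prec s = U := hs
  have hz : ∀ i, ∃ z, MachineComputes (t 0) t.tail (fun _ => i) z ∧
      (X.prod X).Names z ((s : natSpace.carrier → (X.prod X).carrier) ⟨i, mem_natSpace i⟩) := by
    intro i
    obtain ⟨z, hz, y, rfl, hy⟩ := hts (fun _ => i) ⟨i, mem_natSpace i⟩ rfl ⟨_, rfl⟩
    exact ⟨z, hz, hy⟩
  choose z hz hzs using hz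
  have hpp : p.fst.pair p.snd = p := by
    funext n
    rcases Nat.even_or_odd' n with ⟨c, rfl | rfl⟩
    · simp [Baire.pair, Baire.fst]
    · have h : (2 * c + 1) / 2 = c := by omega
      simp [Baire.pair, Baire.snd, Nat.add_mod, h]
  have := hP' o p.fst p.snd u t ht z hz
  rw [hpp] at this
  rw [this, ← hs]
  constructor
  · rintro ⟨i, h1, h2⟩
    rw [accepts_iff_mem hp (hzs i).1] at h1
    rw [accepts_iff_mem hp' (hzs i).2] at h2
    exact ⟨hs ▸ hU, hx, _, h1.2, h2.2⟩
  · rintro ⟨-, -, i, h1, h2⟩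
    refine ⟨i, ?_, ?_⟩
    · rw [accepts_iff_mem hp (hzs i).1]
      exact ⟨mem_carrier (hzs i).1, h1⟩
    · rw [accepts_iff_mem hp' (hzs i).2]
      exact ⟨mem_carrier (hzs i).2, h2⟩

theorem cut_mem_opens (h : (X.prod X).ComputableOpenIn o {z | z ∈ (X.prod X).carrier ∧ prec z.1 z.2})
    {x : α} (hx : x ∈ X.carrier) : X.cut prec x ∈ X.opens.carrier ∧
      X.cut (fun x y => prec y x) x ∈ X.opens.carrier := by
  obtain ⟨W, hW⟩ := names_opens_of_computableOpenIn (fun z hz => hz.1) h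
  obtain ⟨d, u, hdu⟩ := exists_names_cut W
  obtain ⟨p, hp⟩ := hx
  exact ⟨⟨_, (hdu α X prec o hW p x hp).1⟩, _, (hdu α X prec o hW p x hp).2⟩

theorem kappa_mem_opens
    (h : (X.prod X).ComputableOpenIn o {z | z ∈ (X.prod X).carrier ∧ prec z.1 z.2})
    (hb : X.IntervalBaseIn o prec) {x : α} (hx : x ∈ X.carrier) :
    X.kappa x ∈ X.opens.opens.carrier := by
  obtain ⟨⟨p, hp⟩, q, hq⟩ := cut_mem_opens h hx
  obtain ⟨e, he⟩ := exists_machine_cuts_kappa hb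
  obtain ⟨s, -, hs⟩ := he x hx (p.pair q) (by simpa using hp) (by simpa using hq)
  exact ⟨s, hs⟩

/-- Points with the same neighborhoods agree on the open cuts of every `z`, which determine their
own cuts. Conversely, an open set is a union of intervals, and membership in an interval depends on
the cuts only. -/
theorem kappa_eq_iff
    (h : (X.prod X).ComputableOpenIn o {z | z ∈ (X.prod X).carrier ∧ prec z.1 z.2})
    (hb : X.IntervalBaseIn o prec) {x y : α} (hx : x ∈ X.carrier) (hy : y ∈ X.carrier) :
    X.kappa x = X.kappa y ↔ X.cut prec x = X.cut prec y ∧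
      X.cut (fun x y => prec y x) x = X.cut (fun x y => prec y x) y := by
  constructor
  · intro hk
    have key : ∀ U ∈ X.opens.carrier, x ∈ U ↔ y ∈ U := fun U hU =>
      ⟨fun hx => (hk.subset ⟨hU, hx⟩ : _ ∧ _).2, fun hy => (hk.superset ⟨hU, hy⟩ : _ ∧ _).2⟩
    constructor <;> ext z <;> refine and_congr_right fun hz => ?_
    · have := key _ (cut_mem_opens h hz).2
      simpa [cut, hx, hy] using this
    · have := key _ (cut_mem_opens h hz).1
      simpa [cut, hx, hy] using this
  · rintro ⟨h1, h2⟩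
    ext U
    refine and_congr_right fun hU => ?_
    obtain ⟨s, hs, rfl⟩ := hb.surjective U hU
    refine and_congr (iff_of_true hx hy) (exists_congr fun i => ?_)
    have hi := (s i).2
    obtain ⟨r, hr⟩ := hi
    have h1' := Set.ext_iff.1 h1 (s i : α × α).1
    have h2' := Set.ext_iff.1 h2 (s i : α × α).2
    simp only [cut, Set.mem_ofPred_eq, mem_carrier hr.1, mem_carrier hr.2, true_and] at h1' h2'
    exact and_congr h1' h2'

theorem kappaSpace_carrier
    (h : (X.prod X).ComputableOpenIn o {z | z ∈ (X.prod X).carrier ∧ prec z.1 z.2})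
    (hb : X.IntervalBaseIn o prec) : X.kappaSpace.carrier = X.kappa '' X.carrier := by
  refine Set.Subset.antisymm (fun k ⟨p, hp⟩ => hp.2) ?_
  rintro _ ⟨x, hx, rfl⟩
  obtain ⟨p, hp⟩ := kappa_mem_opens h hb hx
  exact ⟨p, hp, x, hx, rfl⟩

theorem kappaSpace_iso_cutMeet
    (h : (X.prod X).ComputableOpenIn o {z | z ∈ (X.prod X).carrier ∧ prec z.1 z.2})
    (hb : X.IntervalBaseIn o prec) :
    ∃ f : X.kappaSpace.carrier ≃ (X.cutMeet prec (fun x y => prec y x)).carrier,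
      ComputableIsoIn o _ _ f ∧
      ∀ x ∈ X.carrier, ∀ k : X.kappaSpace.carrier, (k : Set (Set α)) = X.kappa x →
        (f k : Set α × Set α) = (X.cut prec x, X.cut (fun x y => prec y x) x) := by
  obtain ⟨e, he⟩ := exists_machine_kappa_cuts h
  obtain ⟨e', he'⟩ := exists_machine_cuts_kappa hb
  refine exists_computableIsoIn (C := X.carrier) (a := X.kappa)
    (b := fun x => (X.cut prec x, X.cut (fun x y => prec y x) x)) (kappaSpace_carrier h hb) ?_
    (fun x hx y hy => ?_) (e := e) (e' := e') (fun x hx p hp => ?_) fun x hx p hp => ?_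
  · refine Set.Subset.antisymm (fun k ⟨p, hp⟩ => hp.2) ?_
    rintro _ ⟨x, hx, rfl⟩
    obtain ⟨⟨p, hp⟩, q, hq⟩ := cut_mem_opens h hx
    exact ⟨p.pair q, names_prod (X := X.cutSpace prec) (Y := X.cutSpace fun x y => prec y x)
      ⟨hp, x, hx, rfl⟩ ⟨hq, x, hx, rfl⟩, x, hx, rfl⟩
  · rw [kappa_eq_iff h hb hx hy, Prod.ext_iff]
  · obtain ⟨q, q', hc, hq, hq'⟩ := he x hx p hp.1
    exact ⟨_, hc, names_prod (X := X.cutSpace prec) (Y := X.cutSpace fun x y => prec y x)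
      ⟨hq, x, hx, rfl⟩ ⟨hq', x, hx, rfl⟩, x, hx, rfl⟩
  · obtain ⟨q, hc, hq⟩ := he' x hx p hp.1.1.1 hp.1.2.1
    exact ⟨q, hc, hq, x, hx, rfl⟩

theorem kappaSpace_iso_meet_cutPoints
    (h : (X.prod X).ComputableOpenIn o {z | z ∈ (X.prod X).carrier ∧ prec z.1 z.2})
    (hb : X.IntervalBaseIn o prec) (h₁ : Set.InjOn (X.cut prec) X.carrier)
    (h₂ : Set.InjOn (X.cut (fun x y => prec y x)) X.carrier) :
    ∃ f : X.kappaSpace.carrier ≃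
        ((X.cutPoints prec h₁).meet (X.cutPoints (fun x y => prec y x) h₂)).carrier,
      ComputableIsoIn o _ _ f ∧
      ∀ x ∈ X.carrier, ∀ k : X.kappaSpace.carrier, (k : Set (Set α)) = X.kappa x →
        (f k : α) = x := by
  obtain ⟨e, he⟩ := exists_machine_kappa_cuts h
  obtain ⟨e', he'⟩ := exists_machine_cuts_kappa hb
  refine exists_computableIsoIn (C := X.carrier) (a := X.kappa)
    (b := fun x => x) (kappaSpace_carrier h hb) ?_
    (fun x hx y hy => ?_) (e := e) (e' := e') (fun x hx p hp => ?_) fun x hx p hp => ?_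
  · rw [Set.image_id']
    refine Set.Subset.antisymm (fun k ⟨p, hp⟩ => hp.1.1) fun x hx => ?_
    obtain ⟨⟨p, hp⟩, q, hq⟩ := cut_mem_opens h hx
    exact ⟨p.pair q, names_meet (X := X.cutPoints prec h₁)
      ⟨hx, hp, x, hx, rfl⟩ ⟨hx, hq, x, hx, rfl⟩⟩
  · rw [kappa_eq_iff h hb hx hy]
    exact ⟨fun H => h₁ hx hy H.1, fun H => by simp [H]⟩
  · obtain ⟨q, q', hc, hq, hq'⟩ := he x hx p hp.1
    exact ⟨_, hc, names_meet (X := X.cutPoints prec h₁)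
      ⟨hx, hq, x, hx, rfl⟩ ⟨hx, hq', x, hx, rfl⟩⟩
  · obtain ⟨q, hc, hq⟩ := he' x hx p hp.1.2.1 hp.2.2.1
    exact ⟨q, hc, hq, x, hx, rfl⟩

end Interval

end RepSpace

/-! ### Rational codes and comparison of names -/

/-- A code of `ratOf c + 2 ^ (-k)`. -/
def ratUp (c k : ℕ) : ℕ :=
  Nat.pair (Nat.pair (c.unpair.1.unpair.1 * 2 ^ k + (c.unpair.2 + 1)) (c.unpair.1.unpair.2 * 2 ^ k))
    ((c.unpair.2 + 1) * 2 ^ k - 1)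

/-- A code of `ratOf c - 2 ^ (-k)`. -/
def ratDown (c k : ℕ) : ℕ :=
  Nat.pair (Nat.pair (c.unpair.1.unpair.1 * 2 ^ k) (c.unpair.1.unpair.2 * 2 ^ k + (c.unpair.2 + 1)))
    ((c.unpair.2 + 1) * 2 ^ k - 1)

namespace RepSpace

/-- A code stores the denominator minus one, so the truncated subtraction has to be shown exact. -/
theorem ratOf_pair (a b c k : ℕ) : ratOf (Nat.pair (Nat.pair a b) ((c + 1) * 2 ^ k - 1)) =
    ((a : ℚ) - b) / ((c + 1) * 2 ^ k) := by
  have h : 1 ≤ (c + 1) * 2 ^ k := Nat.one_le_iff_ne_zero.2 (by positivity)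
  simp [ratOf, Nat.cast_sub h]

theorem ratOf_ratUp (c k : ℕ) : (ratOf (ratUp c k) : ℝ) = ratOf c + (1 / 2 : ℝ) ^ k := by
  rw [ratUp, ratOf_pair]
  push_cast [ratOf]
  rw [one_div, inv_pow]
  field_simp
  ring

theorem ratOf_ratDown (c k : ℕ) : (ratOf (ratDown c k) : ℝ) = ratOf c - (1 / 2 : ℝ) ^ k := by
  rw [ratDown, ratOf_pair]
  push_cast [ratOf]
  rw [one_div, inv_pow]
  field_simp
  ring

/-- Cross-multiplying and moving the subtracted terms to the other side leaves an inequality in `ℕ`,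
which is visibly primitive recursive. -/
theorem ratOf_lt_iff (c d : ℕ) : (ratOf c : ℝ) < ratOf d ↔
    c.unpair.1.unpair.1 * (d.unpair.2 + 1) + d.unpair.1.unpair.2 * (c.unpair.2 + 1) <
      d.unpair.1.unpair.1 * (c.unpair.2 + 1) + c.unpair.1.unpair.2 * (d.unpair.2 + 1) := by
  rw [Rat.cast_lt, ratOf, ratOf, div_lt_div_iff₀ (by positivity) (by positivity),
    ← Nat.cast_lt (α := ℚ)]
  push_cast
  constructor <;> intro h <;> linarith

theorem ratOf_surjective : Function.Surjective ratOf := by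
  intro x
  refine ⟨Nat.pair (Nat.pair x.num.toNat (-x.num).toNat) (x.den - 1), ?_⟩
  have h : ((x.num.toNat : ℤ) : ℚ) - (((-x.num).toNat : ℤ) : ℚ) = x.num := by
    rw [← Int.cast_sub, Int.toNat_sub_toNat_neg]
  simp only [Int.cast_natCast] at h
  simp [ratOf, h, Nat.cast_sub x.den_pos, Rat.num_div_den]

theorem exists_ratOf_between {x y : ℝ} (h : x < y) : ∃ c, x < ratOf c ∧ (ratOf c : ℝ) < y := by
  obtain ⟨q, hq⟩ := exists_rat_btwn h
  obtain ⟨c, rfl⟩ := ratOf_surjective q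
  exact ⟨c, hq⟩

section Primrec

theorem primrec_two_pow : Primrec fun k : ℕ => 2 ^ k :=
  (Primrec₂.unpaired'.1 Nat.Primrec.pow).comp (Primrec.const 2) Primrec.id

variable {β : Type} [Primcodable β] {f g : β → ℕ}

theorem primrec_num (hf : Primrec f) : Primrec fun b => (f b).unpair.1.unpair.1 :=
  fst.comp (Primrec.unpair.comp (fst.comp (Primrec.unpair.comp hf)))

theorem primrec_neg (hf : Primrec f) : Primrec fun b => (f b).unpair.1.unpair.2 :=
  snd.comp (Primrec.unpair.comp (fst.comp (Primrec.unpair.comp hf)))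

theorem primrec_den (hf : Primrec f) : Primrec fun b => (f b).unpair.2 + 1 :=
  Primrec.succ.comp (snd.comp (Primrec.unpair.comp hf))

theorem primrec_ratUp (hf : Primrec f) (hg : Primrec g) : Primrec fun b => ratUp (f b) (g b) :=
  have hp := primrec_two_pow.comp hg
  Primrec₂.natPair.comp (Primrec₂.natPair.comp
    (Primrec.nat_add.comp (Primrec.nat_mul.comp (primrec_num hf) hp) (primrec_den hf))
    (Primrec.nat_mul.comp (primrec_neg hf) hp))
    (Primrec.nat_sub.comp (Primrec.nat_mul.comp (primrec_den hf) hp) (Primrec.const 1))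

theorem primrec_ratDown (hf : Primrec f) (hg : Primrec g) : Primrec fun b => ratDown (f b) (g b) :=
  have hp := primrec_two_pow.comp hg
  Primrec₂.natPair.comp (Primrec₂.natPair.comp (Primrec.nat_mul.comp (primrec_num hf) hp)
    (Primrec.nat_add.comp (Primrec.nat_mul.comp (primrec_neg hf) hp) (primrec_den hf)))
    (Primrec.nat_sub.comp (Primrec.nat_mul.comp (primrec_den hf) hp) (Primrec.const 1))

theorem primrecPred_ratOf_lt (hf : Primrec f) (hg : Primrec g) :
    PrimrecPred fun b => (ratOf (f b) : ℝ) < ratOf (g b) := by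
  refine PrimrecPred.of_eq (Primrec.nat_lt.comp
    (Primrec.nat_add.comp (Primrec.nat_mul.comp (primrec_num hf) (primrec_den hg))
      (Primrec.nat_mul.comp (primrec_neg hg) (primrec_den hf)))
    (Primrec.nat_add.comp (Primrec.nat_mul.comp (primrec_num hg) (primrec_den hf))
      (Primrec.nat_mul.comp (primrec_neg hf) (primrec_den hg)))) fun b => (ratOf_lt_iff _ _).symm

/-- Strict comparison of real numbers that are given by names. -/
def NameLT (p q : Baire) : Prop :=
  ∃ n, (ratOf (ratUp (p n) n) : ℝ) < ratOf (ratDown (q n) n)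

theorem semiDec_nameLT {F G : Baire → β → Baire} (hF : ComputableSeq F) (hG : ComputableSeq G) :
    SemiDec fun r b => NameLT (F r b) (G r b) := by
  let P : Baire → ((β × ℕ) × ℕ) × ℕ → Prop := fun r x =>
    (F r x.1.1.1 x.1.1.2 = x.1.2 ∧ G r x.1.1.1 x.1.1.2 = x.2) ∧
      (ratOf (ratUp x.1.2 x.1.1.2) : ℝ) < ratOf (ratDown x.2 x.1.1.2)
  have hP : SemiDec P :=
    ((SemiDec.entry_eq (hF.comp (fst.comp (fst.comp fst))) (snd.comp (fst.comp fst))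
      (snd.comp fst)).and (SemiDec.entry_eq (hG.comp (fst.comp (fst.comp fst)))
      (snd.comp (fst.comp fst)) snd)).and (SemiDec.of_primrecPred (primrecPred_ratOf_lt
        (primrec_ratUp (snd.comp fst) (snd.comp (fst.comp fst)))
        (primrec_ratDown snd (snd.comp (fst.comp fst)))))
  have h1 : SemiDec fun r (x : (β × ℕ) × ℕ) => ∃ d, P r (x, d) :=
    SemiDec.ex (P := fun r (x : (β × ℕ) × ℕ) d => P r (x, d)) hP
  have h2 : SemiDec fun r (x : β × ℕ) => ∃ c d, P r ((x, c), d) :=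
    SemiDec.ex (P := fun r (x : β × ℕ) c => ∃ d, P r ((x, c), d)) h1
  have h3 : SemiDec fun r b => ∃ n c d, P r (((b, n), c), d) :=
    SemiDec.ex (P := fun r b n => ∃ c d, P r (((b, n), c), d)) h2
  refine h3.of_eq fun r b => ?_
  simp [P, NameLT, and_assoc]

end Primrec

/-! ### Real numbers and their cuts -/

theorem exists_pow_half_lt {ε : ℝ} (h : 0 < ε) : ∃ n : ℕ, (1 / 2 : ℝ) ^ n < ε :=
  exists_pow_lt_of_lt_one h (by norm_num)

theorem names_real_iff {p : Baire} {x : ℝ} :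
    realSpace.Names p x ↔ ∀ n, |(ratOf (p n) : ℝ) - x| < (1 / 2 : ℝ) ^ n := Iff.rfl

theorem mem_realSpace (x : ℝ) : x ∈ realSpace.carrier := by
  have h : ∀ n : ℕ, ∃ c, |(ratOf c : ℝ) - x| < (1 / 2 : ℝ) ^ n := by
    intro n
    have hn : (0 : ℝ) < (1 / 2) ^ n := by positivity
    obtain ⟨c, h1, h2⟩ := exists_ratOf_between (show x < x + (1 / 2) ^ n by linarith)
    exact ⟨c, abs_lt.2 ⟨by linarith, by linarith⟩⟩
  choose p hp using h
  exact ⟨p, names_real_iff.2 hp⟩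

theorem names_ratOf (c : ℕ) : realSpace.Names (fun _ => c) (ratOf c) :=
  names_real_iff.2 fun n => by simp

theorem nameLT_iff {p q : Baire} {x y : ℝ} (hp : realSpace.Names p x) (hq : realSpace.Names q y) :
    NameLT p q ↔ x < y := by
  rw [names_real_iff] at hp hq
  simp only [NameLT, ratOf_ratUp, ratOf_ratDown]
  constructor
  · rintro ⟨n, hn⟩
    have h1 := abs_lt.1 (hp n)
    have h2 := abs_lt.1 (hq n)
    linarith
  · intro h
    -- Each of the two approximations errs by less than `2 ^ (-n)` and is shifted by another `2 ^
    -- (-n)`, so the gap must exceed four such terms.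
    obtain ⟨n, hn⟩ := exists_pow_half_lt (show 0 < (y - x) / 4 by linarith)
    have h1 := abs_lt.1 (hp n)
    have h2 := abs_lt.1 (hq n)
    exact ⟨n, by linarith⟩

theorem cut_realSpace (R : ℝ → ℝ → Prop) (x : ℝ) : realSpace.cut R x = {y | R y x} :=
  Set.ext fun y => and_iff_right (mem_realSpace y)

theorem names_realLower {p : Baire} {x : ℝ} :
    realLower.Names p x ↔ realSpace.opens.Names p {y | y < x} := by
  rw [← cut_realSpace]
  exact ⟨fun h => h.2.1, fun h => ⟨mem_realSpace x, h, x, mem_realSpace x, rfl⟩⟩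

theorem names_realUpper {p : Baire} {x : ℝ} :
    realUpper.Names p x ↔ realSpace.opens.Names p {y | x < y} := by
  have : realSpace.cut (fun x y => x > y) x = {y | x < y} := cut_realSpace _ _
  rw [← this]
  exact ⟨fun h => h.2.1, fun h => ⟨mem_realSpace x, h, x, mem_realSpace x, rfl⟩⟩

theorem exists_machine_real_cuts : ∃ e, ∀ x p, realSpace.Names p x → ∃ q,
    MachineComputes e 0 p q ∧ (realLower.meet realUpper).Names q x := by
  have id : ComputableSeq fun r (_ : Unit) => r := ComputableSeq.id
  obtain ⟨l, hl⟩ := (semiDec_nameLT id.snd id.fst).exists_names_opens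
  obtain ⟨u, hu⟩ := (semiDec_nameLT id.fst id.snd).exists_names_opens
  obtain ⟨e, he⟩ := ((id.snd.cons l).pair (id.snd.cons u)).exists_machine
  refine ⟨e, fun x p hp => ⟨_, he 0 p, names_meet (names_realLower.2 ?_) (names_realUpper.2 ?_)⟩⟩
  · refine hl _ _ _ _ (fun y _ => mem_realSpace y) fun q y hq => ?_
    simpa using nameLT_iff hq hp
  · refine hu _ _ _ _ (fun y _ => mem_realSpace y) fun q y hq => ?_
    simpa using nameLT_iff hp hq

theorem exists_machine_cuts_real : ∃ e, ∀ x p, (realLower.meet realUpper).Names p x → ∃ q,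
    MachineComputes e 0 p q ∧ realSpace.Names q x := by
  have id : ComputableSeq fun r (_ : ℕ × ℕ) => r := ComputableSeq.id
  have h : SemiDec fun r (x : ℕ × ℕ) => Accepts r.snd.fst (fun _ => ratDown x.2 x.1) ∧
      Accepts r.snd.snd (fun _ => ratUp x.2 x.1) :=
    (SemiDec.accepts id.snd.fst (ComputableSeq.const (primrec_ratDown snd fst))).and
      (SemiDec.accepts id.snd.snd (ComputableSeq.const (primrec_ratUp snd fst)))
  obtain ⟨e, he⟩ := exists_machine_select (G := fun r k c =>
    Accepts r.snd.fst (fun _ => ratDown c k) ∧ Accepts r.snd.snd (fun _ => ratUp c k)) h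
  refine ⟨e, fun x p hp => ?_⟩
  have key : ∀ k c, (Accepts p.fst (fun _ => ratDown c k) ∧ Accepts p.snd fun _ => ratUp c k) ↔
      |(ratOf c : ℝ) - x| < (1 / 2 : ℝ) ^ k := by
    intro k c
    rw [accepts_iff_mem (names_realLower.1 hp.1) (names_ratOf _),
      accepts_iff_mem (names_realUpper.1 hp.2) (names_ratOf _), Set.mem_ofPred_eq,
      Set.mem_ofPred_eq, ratOf_ratDown, ratOf_ratUp, abs_lt]
    constructor <;> rintro ⟨h1, h2⟩ <;> constructor <;> linarith
  -- Any name of `x` shows that the search succeeds for every `k`; the machine need not find that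
  -- name.
  obtain ⟨q, hq, hq'⟩ := he (Baire.pair 0 p) fun k => by
    obtain ⟨q, hq⟩ := mem_realSpace x
    exact ⟨q k, by simpa [key] using names_real_iff.1 hq k⟩
  refine ⟨q, hq, names_real_iff.2 fun k => (key _ _).1 ?_⟩
  simpa using hq' k

theorem realSpace_iso : ∃ f : realSpace.carrier ≃ (realLower.meet realUpper).carrier,
    ComputableIsoIn 0 _ _ f ∧ ∀ x, (f x : ℝ) = x := by
  obtain ⟨e, he⟩ := exists_machine_real_cuts
  obtain ⟨e', he'⟩ := exists_machine_cuts_real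
  obtain ⟨f, hf, hfx⟩ := exists_computableIsoIn (X := realSpace) (Y := realLower.meet realUpper)
    (o := 0) (C := Set.univ) (a := fun x => x) (b := fun x => x) (e := e) (e' := e')
    (by simpa using Set.eq_univ_of_forall mem_realSpace)
    (by
      rw [Set.image_id']
      refine Set.eq_univ_of_forall fun x => ?_
      obtain ⟨p, hp⟩ := mem_realSpace x
      obtain ⟨q, -, hq⟩ := he x p hp
      exact mem_carrier hq)
    (fun _ _ _ _ => Iff.rfl) (fun x _ p hp => he x p hp) fun x _ p hp => he' x p hp
  exact ⟨f, hf, fun x => hfx x trivial x rfl⟩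

/-! ### Rays, compactness and the maximum -/

/-- Unions of left rays and of right rays have names that are computable from the ends. -/
theorem exists_names_rays : ∃ l u : ℕ, ∀ h : Baire,
    realSpace.opens.Names (Baire.cons l h) {x | ∃ i, x < ratOf (h i)} ∧
    realSpace.opens.Names (Baire.cons u h) {x | ∃ i, ratOf (h i) < x} := by
  have id : ComputableSeq fun r (_ : (Unit × ℕ) × ℕ) => r := ComputableSeq.id
  have hc : ComputableSeq fun (_ : Baire) (x : (Unit × ℕ) × ℕ) _ => x.2 := ComputableSeq.const snd
  have h0 : SemiDec fun r (x : (Unit × ℕ) × ℕ) => r.fst x.1.2 = x.2 :=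
    SemiDec.entry_eq id.fst (snd.comp fst) snd
  have hl : SemiDec fun r (_ : Unit) => ∃ i, ∃ c, r.fst i = c ∧ NameLT r.snd fun _ => c :=
    SemiDec.ex (P := fun r (_ : Unit) i => ∃ c, r.fst i = c ∧ NameLT r.snd fun _ => c)
      (SemiDec.ex (P := fun r (x : Unit × ℕ) c => r.fst x.2 = c ∧ NameLT r.snd fun _ => c)
        (h0.and (semiDec_nameLT id.snd hc)))
  have hu : SemiDec fun r (_ : Unit) => ∃ i, ∃ c, r.fst i = c ∧ NameLT (fun _ => c) r.snd :=
    SemiDec.ex (P := fun r (_ : Unit) i => ∃ c, r.fst i = c ∧ NameLT (fun _ => c) r.snd)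
      (SemiDec.ex (P := fun r (x : Unit × ℕ) c => r.fst x.2 = c ∧ NameLT (fun _ => c) r.snd)
        (h0.and (semiDec_nameLT hc id.snd)))
  obtain ⟨l, hl⟩ := hl.exists_names_opens
  obtain ⟨u, hu⟩ := hu.exists_names_opens
  refine ⟨l, u, fun h => ⟨hl _ _ _ _ (fun y _ => mem_realSpace y) fun q y hq => ?_,
    hu _ _ _ _ (fun y _ => mem_realSpace y) fun q y hq => ?_⟩⟩
  · simp [nameLT_iff hq (names_ratOf _)]
  · simp [nameLT_iff (names_ratOf _) hq]

/-- A compact set that is covered by left rays is contained in one of them. -/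
theorem exists_subset_Iio {p : Baire} {A : Set ℝ}
    (hp : realSpace.opens.opens.Names p {U | U ∈ realSpace.opens.carrier ∧ A ⊆ U}) (h : Baire)
    (hAh : A ⊆ {x | ∃ i, x < ratOf (h i)}) : ∃ i, A ⊆ Set.Iio (ratOf (h i) : ℝ) := by
  obtain ⟨l, u, hl⟩ := exists_names_rays
  have id : ComputableSeq fun r (_ : Unit) => r := ComputableSeq.id
  have hacc : ∀ h : Baire, Accepts p (Baire.cons l h) ↔ A ⊆ {x | ∃ i, x < ratOf (h i)} := by
    intro h
    rw [accepts_iff_mem hp (hl h).1]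
    exact and_iff_right (mem_carrier (hl h).1)
  -- Only continuity is used here: acceptance of the cover named by `h` depends on a finite part of
  -- `h`.
  obtain ⟨D, -, hD⟩ := SemiDec.accepts id.fst (id.snd.cons l)
  obtain ⟨m, hm⟩ := (hD (p.pair h) ()).1 (by simpa [hacc] using hAh)
  -- `h'` repeats the ray `h 0` beyond index `m`, so the machine cannot distinguish it from `h`, yet
  -- it lists finitely many rays. The largest of the first `m + 1` rays then contains `A`.
  let h' : Baire := fun i => h (if i ≤ m then i else 0)
  have hh' : (p.pair h').take m = (p.pair h).take m := by
    refine Baire.take_congr fun i hi => ?_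
    have : i / 2 ≤ m := by omega
    simp [Baire.pair, h', this]
  have hAh' : A ⊆ {x | ∃ i, x < ratOf (h' i)} := by
    rw [← hacc]
    simpa using (hD (p.pair h') ()).2 ⟨m, by rwa [hh']⟩
  obtain ⟨j, hj, hmax⟩ := Finset.exists_max_image (Finset.range (m + 1))
    (fun i => (ratOf (h i) : ℝ)) ⟨0, by simp⟩
  refine ⟨j, fun x hx => ?_⟩
  obtain ⟨i, hi⟩ := hAh' hx
  refine lt_of_lt_of_le hi (hmax _ ?_)
  rw [Finset.mem_range]
  split_ifs <;> omega

/-- A nonempty compact set of real numbers has a greatest element. -/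
theorem exists_isGreatest {p : Baire} {A : Set ℝ} (hA : A.Nonempty)
    (hp : realSpace.opens.opens.Names p {U | U ∈ realSpace.opens.carrier ∧ A ⊆ U}) :
    ∃ x, IsGreatest A x := by
  have hb : BddAbove A := by
    choose c hc using fun n : ℕ => ratOf_surjective n
    obtain ⟨i, hi⟩ := exists_subset_Iio hp c fun x _ => by
      obtain ⟨n, hn⟩ := exists_nat_gt x
      exact ⟨n, by simpa [hc] using hn⟩
    exact ⟨_, fun x hx => (hi hx).le⟩
  refine ⟨sSup A, ?_, fun x hx => le_csSup hb hx⟩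
  by_contra hs
  have hlt : ∀ x ∈ A, x < sSup A := fun x hx =>
    (le_csSup hb hx).lt_of_ne fun h => hs (h ▸ hx)
  -- If the supremum is not attained, left rays with rational ends increasing to it within `2 ^
  -- (-n)` cover `A`. One of them would contain `A`, making its end a smaller upper bound.
  have hc : ∀ n : ℕ, ∃ c, sSup A - (1 / 2) ^ n < ratOf c ∧ (ratOf c : ℝ) < sSup A := fun n =>
    exists_ratOf_between (sub_lt_self _ (by positivity))
  choose c hc hc' using hc
  obtain ⟨i, hi⟩ := exists_subset_Iio hp c fun x hx => by
    obtain ⟨n, hn⟩ := exists_pow_half_lt (sub_pos.2 (hlt x hx))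
    exact ⟨n, by linarith [hc n]⟩
  exact absurd (csSup_le hA fun x hx => (hi hx).le) (not_le.2 (hc' i))

theorem exists_isGreatest_of_mem {A : Set ℝ}
    (hA : A ∈ (realSpace.compacts.meet realSpace.overts).carrier) (hne : A.Nonempty) :
    ∃ x ∈ realSpace.carrier, IsGreatest A x := by
  obtain ⟨p, hp, -⟩ := hA
  obtain ⟨x, hx⟩ := exists_isGreatest hne hp.2.2.2
  exact ⟨x, mem_realSpace x, hx⟩

/-- The two kinds of information are complementary: compactness confirms upper bounds of the
maximum, overtness confirms lower bounds. Constant sequences name single rays. -/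
theorem computable_max : ComputableMultiIn 0 (realSpace.compacts.meet realSpace.overts) realSpace
    (fun A => {x | IsGreatest (A : Set ℝ) (x : ℝ)}) := by
  obtain ⟨l, u, hlu⟩ := exists_names_rays
  have id : ComputableSeq fun r (_ : ℕ × ℕ) => r := ComputableSeq.id
  have h : SemiDec fun r (x : ℕ × ℕ) =>
      Accepts r.snd.fst (Baire.cons l fun _ => ratUp x.2 x.1) ∧
      Accepts r.snd.snd (Baire.cons u fun _ => ratDown x.2 x.1) :=
    (SemiDec.accepts id.snd.fst ((ComputableSeq.const (primrec_ratUp snd fst)).cons l)).and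
      (SemiDec.accepts id.snd.snd ((ComputableSeq.const (primrec_ratDown snd fst)).cons u))
  obtain ⟨e, he⟩ := exists_machine_select (G := fun r k c =>
    Accepts r.snd.fst (Baire.cons l fun _ => ratUp c k) ∧
      Accepts r.snd.snd (Baire.cons u fun _ => ratDown c k)) h
  refine ⟨e, fun p ⟨A, hA⟩ hp ⟨⟨x, hx⟩, hxA⟩ => ?_⟩
  have hxA : IsGreatest A x := hxA
  obtain ⟨⟨-, -, -, hK⟩, B, -, hBA, hV⟩ := hp
  have hBA : realSpace.closureIn B = A := hBA
  -- The name in `V` speaks of a set `B` of which only the closure is `A`. Being contained in `A`,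
  -- `B` has no element above `x`; as `x` is in its closure, every open ray that contains `x` meets
  -- `B`.
  have hBsub : B ⊆ A := fun y hy => hBA ▸ ⟨mem_realSpace y, fun U _ hyU => ⟨y, hyU, hy⟩⟩
  have key : ∀ k c, (Accepts p.fst (Baire.cons l fun _ => ratUp c k) ∧
      Accepts p.snd (Baire.cons u fun _ => ratDown c k)) ↔
      |(ratOf c : ℝ) - x| < (1 / 2 : ℝ) ^ k := by
    intro k c
    have hl := (hlu fun _ => ratUp c k).1
    have hu := (hlu fun _ => ratDown c k).2
    have h1 : A ⊆ {y | ∃ _ : ℕ, y < ratOf (ratUp c k)} ↔ x < ratOf (ratUp c k) :=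
      ⟨fun H => (H hxA.1).elim fun _ h => h, fun H y hy => ⟨0, (hxA.2 hy).trans_lt H⟩⟩
    have h2 : ({y : ℝ | ∃ _ : ℕ, ratOf (ratDown c k) < y} ∩ B).Nonempty ↔
        ratOf (ratDown c k) < x := by
      constructor
      · rintro ⟨y, ⟨_, hy⟩, hyB⟩
        exact hy.trans_le (hxA.2 (hBsub hyB))
      · intro H
        have hxB : x ∈ realSpace.closureIn B := hBA ▸ hxA.1
        exact hxB.2 _ (mem_carrier hu) ⟨0, H⟩
    rw [accepts_iff_mem hK hl, accepts_iff_mem hV hu]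
    refine (and_congr ((and_iff_right (mem_carrier hl)).trans h1)
      ((and_iff_right (mem_carrier hu)).trans h2)).trans ?_
    rw [ratOf_ratDown, ratOf_ratUp, abs_lt]
    constructor <;> rintro ⟨h1, h2⟩ <;> constructor <;> linarith
  obtain ⟨q, hq, hq'⟩ := he (Baire.pair 0 p) fun k => by
    obtain ⟨q, hq⟩ := mem_realSpace x
    exact ⟨q k, by simpa [key] using names_real_iff.1 hq k⟩
  refine ⟨q, hq, ⟨x, hx⟩, hxA, names_real_iff.2 fun k => (key _ _).1 ?_⟩
  simpa using hq' k

end RepSpace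

/-! ### The assembled statement -/

theorem proposition43 :
    (∀ (α : Type*) (X : RepSpace α) (prec : α → α → Prop) (o : Baire),
      (X.prod X).ComputableOpenIn o {z | z ∈ (X.prod X).carrier ∧ prec z.1 z.2} →
      X.IntervalBaseIn o prec →
        (∃ f : X.kappaSpace.carrier ≃ (X.cutMeet prec (fun x y => prec y x)).carrier,
          RepSpace.ComputableIsoIn o _ _ f ∧
          ∀ x ∈ X.carrier, ∀ k : X.kappaSpace.carrier, (k : Set (Set α)) = X.kappa x →
            (f k : Set α × Set α) = (X.cut prec x, X.cut (fun x y => prec y x) x)) ∧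
        ∀ (h₁ : Set.InjOn (X.cut prec) X.carrier)
          (h₂ : Set.InjOn (X.cut (fun x y => prec y x)) X.carrier),
          ∃ f : X.kappaSpace.carrier ≃
              ((X.cutPoints prec h₁).meet (X.cutPoints (fun x y => prec y x) h₂)).carrier,
            RepSpace.ComputableIsoIn o _ _ f ∧
            ∀ x ∈ X.carrier, ∀ k : X.kappaSpace.carrier, (k : Set (Set α)) = X.kappa x →
              (f k : α) = x) ∧
    (∃ f : RepSpace.realSpace.carrier ≃ (RepSpace.realLower.meet RepSpace.realUpper).carrier,
      RepSpace.ComputableIsoIn 0 _ _ f ∧ ∀ x, (f x : ℝ) = x) ∧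
    (∀ A ∈ (RepSpace.realSpace.compacts.meet RepSpace.realSpace.overts).carrier, A.Nonempty →
      ∃ x ∈ RepSpace.realSpace.carrier, IsGreatest A x) ∧
    RepSpace.ComputableMultiIn 0 (RepSpace.realSpace.compacts.meet RepSpace.realSpace.overts)
      RepSpace.realSpace (fun A => {x | IsGreatest (A : Set ℝ) (x : ℝ)}) :=
  ⟨fun _ _ _ _ h hb => ⟨RepSpace.kappaSpace_iso_cutMeet h hb,
      fun h₁ h₂ => RepSpace.kappaSpace_iso_meet_cutPoints h hb h₁ h₂⟩,
    RepSpace.realSpace_iso, fun _ hA hne => RepSpace.exists_isGreatest_of_mem hA hne,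
    RepSpace.computable_max⟩
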